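/- Let $\Bbbk\in\{\mathbb{R},\mathbb{C}\}$, let $m,n\ge 0$, let $\pi\subseteq\{1,\dots,m\}$, $k=\sharp\pi$. For $A\in\Bbbk^{m\times n}$ let $A=U\widehat\Sigma V^H$ be a full singular value decomposition over $\Bbbk$, with singular values $\sigma_1\ge\sigma_2\ge\cdots$ ($\sigma_i=0$ for $i>\operatorname{rank}A$), and let $\mathrm{U}_\pi\subseteq\Bbbk^m$ be the span of the columns of $U$ at the positions in $\pi$. A left singular subspace of $A$ is a sum $\bigoplus_{\sigma\in S}\ker(AA^H-\sigma^2 I)$ over a set $S$ of singular values of $A$, where $0\in S$ is also allowed. Let $\mathcal{U}_\pi^{\Bbbk}\subseteq\Bbbk^{m\times n}$ be the set of those $A$ for which $\mathrm{U}_\pi$ is a left singular subspace of $A$ (on this set $\mathrm{U}_\pi$ depends on $A$ only), and let \[ \mathcal{L}_\pi^{\Bbbk}:\mathcal{U}_\pi^{\Bbbk}\to\mathrm{Gr}(k,\Bbbk^m)=\{QQ^H : Q\in\Bbbk^{m\times k},\ Q^HQ=I_k\} \] send $A$ to the orthogonal projector onto $\mathrm{U}_\pi$. For $P=QQ^H$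 and $P'=Q'Q'^H$ in $\mathrm{Gr}(k,\Bbbk^m)$ let $\theta_i=\arccos\sigma_i(Q^HQ')$, $i=1,\dots,k$, be the principal angles, and let $d(P,P')$ be one of the chordal distance $\|(\sin\theta_i)_i\|_2$, the Grassmann distance $\|(\theta_i)_i\|_2$ and the Procrustes distance $\|(2\sin(\theta_i/2))_i\|_2$. For $A\in\mathcal{U}_\pi^{\Bbbk}$ let \[ \kappa[\mathcal{L}_\pi^{\Bbbk}](A)=\lim_{\epsilon\to0^+}\ \sup_{\substack{A'\in\mathcal{U}_\pi^{\Bbbk},\\ 0<\|A-A'\|_F\le\epsilon}}\frac{d(\mathcal{L}_\pi^{\Bbbk}(A),\mathcal{L}_\pi^{\Bbbk}(A'))}{\|A-A'\|_F}\in[0,\infty] \] (the supremum over the empty set being $0$), and let $\kappa[\mathcal{L}_\pi^{\Bbbk}](A)=\infty$ for $A\notin\mathcal{U}_\pi^{\Bbbk}$. Then, for each of the three distances and every real matrix $A\in\mathbb{R}^{m\times n}$, allowing complex perturbations of $A$ does not change the condition number: \[ \kappa[\mathcal{L}_\pi^{\mathbb{R}}](A)=\kappa[\mathcal{L}_\pi^{\mathbb{C}}](A).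 \] -/

import Mathlib

open scoped Matrix ENNReal Topology

namespace SingularSubspace

noncomputable section

/-! ### Rice's condition number -/

/-- The supremum of `dY (f x) (f x') / dX x x'` over all `x' ≠ x` in `X` with `dX x x' ≤ ε`,
as an extended nonnegative real. -/
def localRatio {X Y : Type*} (dX : X → X → ℝ) (dY : Y → Y → ℝ) (f : X → Y) (x : X) (ε : ℝ) :
    ℝ≥0∞ :=
  ⨆ (x' : X) (_ : 0 < dX x x' ∧ dX x x' ≤ ε), ENNReal.ofReal (dY (f x) (f x') / dX x x')

/-- Rice's condition number of `f` at `x` with respect to the distances `dX` and `dY`: the limit of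
`localRatio dX dY f x ε` as `ε → 0+`. As the ratio is monotone in `ε`, this limit is its infimum
over `ε > 0`, see `tendsto_localRatio`. -/
def riceCond {X Y : Type*} (dX : X → X → ℝ) (dY : Y → Y → ℝ) (f : X → Y) (x : X) : ℝ≥0∞ :=
  ⨅ (ε : ℝ) (_ : 0 < ε), localRatio dX dY f x ε

theorem localRatio_mono {X Y : Type*} (dX : X → X → ℝ) (dY : Y → Y → ℝ) (f : X → Y) (x : X) :
    Monotone (localRatio dX dY f x) := by
  intro a b hab
  exact iSup_mono fun x' => iSup_mono' fun h => ⟨⟨h.1, h.2.trans hab⟩, le_rfl⟩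

theorem tendsto_localRatio {X Y : Type*} (dX : X → X → ℝ) (dY : Y → Y → ℝ) (f : X → Y) (x : X) :
    Filter.Tendsto (localRatio dX dY f x) (𝓝[>] 0) (𝓝 (riceCond dX dY f x)) := by
  have h := (localRatio_mono dX dY f x).tendsto_nhdsGT 0
  rw [sInf_image] at h
  exact h

/-! ### Singular values, singular value decompositions, left singular subspaces -/

section Matrices

variable {𝕜 : Type*} [RCLike 𝕜] {m n : ℕ}

/-- The Euclidean (Frobenius) distance between two matrices. -/
def frobDist (A B : Matrix (Fin m) (Fin n) 𝕜) : ℝ :=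
  Real.sqrt (∑ i, ∑ j, ‖A i j - B i j‖ ^ 2)

/-- The singular values of `A` in decreasing order (indexed from `0`), continued by zeros:
the first `rank A` of them are positive, all others are `0`. -/
def singVal (A : Matrix (Fin m) (Fin n) 𝕜) (i : ℕ) : ℝ :=
  (Matrix.toEuclideanLin A).singularValues i

/-- The `m × n` matrix with the singular values of `A` on its diagonal and zeros elsewhere. -/
def singValMatrix (A : Matrix (Fin m) (Fin n) 𝕜) : Matrix (Fin m) (Fin n) 𝕜 :=
  Matrix.of fun i j => if (i : ℕ) = (j : ℕ) then (singVal A (i : ℕ) : 𝕜) else 0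

/-- `U` and `V` are the unitary factors of a full singular value decomposition of `A`. -/
structure IsFullSVD (A : Matrix (Fin m) (Fin n) 𝕜) (U : Matrix (Fin m) (Fin m) 𝕜)
    (V : Matrix (Fin n) (Fin n) 𝕜) : Prop where
  left_unitary : U ∈ Matrix.unitaryGroup (Fin m) 𝕜
  right_unitary : V ∈ Matrix.unitaryGroup (Fin n) 𝕜
  eq_mul : A = U * singValMatrix A * Vᴴ

/-- The left singular subspace of `A` associated with the number `s ≥ 0`: the eigenspace of
`A * Aᴴ` for `s ^ 2`. For `s = 0` it is the cokernel of `A`, i.e. the kernel of `Aᴴ`. -/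
def basicLeft (A : Matrix (Fin m) (Fin n) 𝕜) (s : ℝ) : Submodule 𝕜 (Fin m → 𝕜) :=
  Module.End.eigenspace (Matrix.toLin' (A * Aᴴ)) ((s ^ 2 : ℝ) : 𝕜)

/-- `W` is a left singular subspace of `A`: the sum of the left singular subspaces associated with
the elements of some set `S` of singular values of `A`, where `0` is also allowed. -/
def IsLeftSingularSubspace (A : Matrix (Fin m) (Fin n) 𝕜) (W : Submodule 𝕜 (Fin m → 𝕜)) : Prop :=
  ∃ S : Set ℝ, S ⊆ insert 0 (Set.range (singVal A)) ∧ W = ⨆ s ∈ S, basicLeft A s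

/-- The span of the columns of `U` at the positions in `π`. -/
def colSpan (U : Matrix (Fin m) (Fin m) 𝕜) (π : Finset (Fin m)) : Submodule 𝕜 (Fin m → 𝕜) :=
  Submodule.span 𝕜 ((fun i : Fin m => U.col i) '' (π : Set (Fin m)))

/-- The set of `m × n` matrices for which the span of the left singular vectors at the positions
in `π` is a left singular subspace. -/
def domain (𝕜 : Type*) [RCLike 𝕜] (m n : ℕ) (π : Finset (Fin m)) :
    Set (Matrix (Fin m) (Fin n) 𝕜) :=
  {A | ∃ U V, IsFullSVD A U V ∧ IsLeftSingularSubspace A (colSpan U π)}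

/-! ### The Grassmannian and its distances -/

/-- The Grassmannian of `d`-dimensional subspaces of `𝕜 ^ p`, as the set of orthogonal projectors
`Q * Qᴴ` of rank `d`. -/
def Gr (𝕜 : Type*) [RCLike 𝕜] (d p : ℕ) : Type _ :=
  {P : Matrix (Fin p) (Fin p) 𝕜 // ∃ Q : Matrix (Fin p) (Fin d) 𝕜, Qᴴ * Q = 1 ∧ P = Q * Qᴴ}

/-- A matrix `Q` with orthonormal columns such that `P = Q * Qᴴ`. -/
def Gr.frame {d p : ℕ} (P : Gr 𝕜 d p) : Matrix (Fin p) (Fin d) 𝕜 :=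
  Classical.choose P.2

/-- The `i`-th principal angle between `P = Q * Qᴴ` and `P' = Q' * Q'ᴴ`, the inverse cosine of the
`i`-th singular value of `Qᴴ * Q'`. It does not depend on the choice of `Q` and `Q'`. -/
def Gr.angle {d p : ℕ} (P P' : Gr 𝕜 d p) (i : Fin d) : ℝ :=
  Real.arccos (singVal (P.frameᴴ * P'.frame) (i : ℕ))

/-- The names of the three distances on the Grassmannian. -/
inductive GrDistance : Type where
  | chordal
  | grassmann
  | procrustes

/-- The chordal, Grassmann and Procrustes distance: the Euclidean norms of the vectors
`sin θ`, `θ` and `2 sin (θ / 2)`, where `θ` is the vector of principal angles. -/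
def Gr.dist {d p : ℕ} : GrDistance → Gr 𝕜 d p → Gr 𝕜 d p → ℝ
  | .chordal, P, P' => Real.sqrt (∑ i, Real.sin (P.angle P' i) ^ 2)
  | .grassmann, P, P' => Real.sqrt (∑ i, P.angle P' i ^ 2)
  | .procrustes, P, P' => Real.sqrt (∑ i, (2 * Real.sin (P.angle P' i / 2)) ^ 2)

/-! ### The map sending a matrix to its selected left singular subspace -/

/-- The columns of `U` at the positions in `π`, in increasing order. -/
def selectCols (U : Matrix (Fin m) (Fin m) 𝕜) (π : Finset (Fin m)) :
    Matrix (Fin m) (Fin π.card) 𝕜 :=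
  U.submatrix id (π.orderEmbOfFin rfl)

theorem selectCols_orthonormal {U : Matrix (Fin m) (Fin m) 𝕜}
    (hU : U ∈ Matrix.unitaryGroup (Fin m) 𝕜) (π : Finset (Fin m)) :
    (selectCols U π)ᴴ * selectCols U π = 1 := by
  have h : Uᴴ * U = 1 := Matrix.mem_unitaryGroup_iff'.mp hU
  have h2 : (selectCols U π)ᴴ * selectCols U π =
      (Uᴴ * U).submatrix (π.orderEmbOfFin rfl) (π.orderEmbOfFin rfl) := by
    ext i j
    simp [selectCols, Matrix.mul_apply]
  rw [h2, h, Matrix.submatrix_one _ (π.orderEmbOfFin rfl).injective]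

/-- The unitary left factor of a full singular value decomposition of `A`. -/
def leftFactor {π : Finset (Fin m)} (A : domain 𝕜 m n π) : Matrix (Fin m) (Fin m) 𝕜 :=
  Classical.choose A.2

theorem leftFactor_spec {π : Finset (Fin m)} (A : domain 𝕜 m n π) :
    ∃ V, IsFullSVD (A : Matrix (Fin m) (Fin n) 𝕜) (leftFactor A) V ∧
      IsLeftSingularSubspace (A : Matrix (Fin m) (Fin n) 𝕜) (colSpan (leftFactor A) π) :=
  Classical.choose_spec A.2

/-- The map that sends `A` to the span of its left singular vectors at the positions in `π`, a point
of the Grassmannian. On the given domain it does not depend on the singular value decomposition. -/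
def leftMap (𝕜 : Type*) [RCLike 𝕜] (m n : ℕ) (π : Finset (Fin m)) (A : domain 𝕜 m n π) :
    Gr 𝕜 π.card m :=
  ⟨selectCols (leftFactor A) π * (selectCols (leftFactor A) π)ᴴ, selectCols (leftFactor A) π,
    selectCols_orthonormal (leftFactor_spec A).choose_spec.1.left_unitary π, rfl⟩

open Classical in
/-- The condition number at `A` of the map `leftMap`, with respect to the Euclidean distance on the
domain and the distance `δ` on the Grassmannian; it is `∞` if `A` is not in the domain. -/
def condLeft (δ : GrDistance) (π : Finset (Fin m)) (A : Matrix (Fin m) (Fin n) 𝕜) : ℝ≥0∞ :=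
  if hA : A ∈ domain 𝕜 m n π then
    riceCond (fun B C : domain 𝕜 m n π =>
        frobDist (B : Matrix (Fin m) (Fin n) 𝕜) (C : Matrix (Fin m) (Fin n) 𝕜))
      (Gr.dist δ) (leftMap 𝕜 m n π) ⟨A, hA⟩
  else ⊤

end Matrices

end

end SingularSubspace

/-!
The condition number is computed in closed form over both fields at once. For `A` in the domain of
the map it is the maximum, over `i ∈ π` and `j ∉ π`, of

  `√(σ_i ^ 2 + σ_j ^ 2) / |σ_i ^ 2 - σ_j ^ 2|`,

and `A` lies in the domain exactly if `σ_i ≠ σ_j` for all such pairs (`mem_domain_iff`). As a real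
matrix has the same singular values over the real and over the complex numbers
(`singVal_map_ofReal`), the two condition numbers agree.

Upper bound: let `X = Uᴴ * U'` compare the left singular vectors of `A` and `A' = A + E`. Its block
with rows outside and columns inside of `π` has the chordal distance as its Frobenius norm
(`Gr.dist_chordal_eq_sinNorm`). The entries of the block satisfy the exact identity
`x_ij * (σ'_j ^ 2 - σ_i ^ 2) = f_ij * σ'_j + σ_i * g_ij`, where `f` and `g` are blocks of `E` and
`Eᴴ` in the singular bases (`IsFullSVD.perturbation_identity`). Up to a higher order term these two
blocks of `E` lie in complementary rows, so that together they are bounded by `‖E‖` (`sinNorm_le`).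
Weyl's inequality (`singVal_sub_le`) provides the continuity of the singular values. The three
distances agree to first order, so that the bound for the chordal one suffices.

Lower bound: rotate the left singular vectors `i` and `j` by a small angle, and the right ones by an
angle with proportional sine. This keeps the singular values and moves the subspace by the first
angle; with the best proportion the movement of `A` attains the bound
(`exists_extremal_perturbation`).
-/

namespace SingularSubspace

noncomputable section

attribute [local instance] Matrix.frobeniusNormedAddCommGroup

/-! ### Frobenius norms and truncations -/

section Frobenius

variable {𝕜 : Type*} [RCLike 𝕜]

theorem frobenius_sq {p q : Type*} [Fintype p] [Fintype q] (M : Matrix p q 𝕜) :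
    ‖M‖ ^ 2 = ∑ i, ∑ j, ‖M i j‖ ^ 2 := by
  rw [Matrix.frobenius_norm_def, ← Real.sqrt_eq_rpow, Real.sq_sqrt]
  · simp
  · positivity

theorem frobDist_eq_norm {m n : ℕ} (A B : Matrix (Fin m) (Fin n) 𝕜) :
    frobDist A B = ‖A - B‖ := by
  rw [frobDist, ← Real.sqrt_sq (norm_nonneg (A - B)), frobenius_sq]
  simp

theorem frobenius_sq_eq_trace {p q : Type*} [Fintype p] [Fintype q] (M : Matrix p q 𝕜) :
    ((‖M‖ ^ 2 : ℝ) : 𝕜) = (Mᴴ * M).trace := by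
  rw [frobenius_sq, Finset.sum_comm]
  simp [Matrix.trace, Matrix.mul_apply, RCLike.conj_mul]

theorem frobenius_mul_left {p q r : Type*} [Fintype p] [Fintype q] [Fintype r] [DecidableEq q]
    {U : Matrix p q 𝕜} (hU : Uᴴ * U = 1) (M : Matrix q r 𝕜) : ‖U * M‖ = ‖M‖ := by
  have h : ((‖U * M‖ ^ 2 : ℝ) : 𝕜) = ((‖M‖ ^ 2 : ℝ) : 𝕜) := by
    rw [frobenius_sq_eq_trace, frobenius_sq_eq_trace, Matrix.conjTranspose_mul, Matrix.mul_assoc,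
      ← Matrix.mul_assoc Uᴴ, hU, Matrix.one_mul]
  have h2 : ‖U * M‖ ^ 2 = ‖M‖ ^ 2 := by exact_mod_cast h
  exact (sq_eq_sq₀ (norm_nonneg _) (norm_nonneg _)).mp h2

theorem frobenius_mul_right {p q r : Type*} [Fintype p] [Fintype q] [Fintype r] [DecidableEq q]
    {U : Matrix q r 𝕜} (hU : U * Uᴴ = 1) (M : Matrix p q 𝕜) : ‖M * U‖ = ‖M‖ := by
  rw [← Matrix.frobenius_norm_conjTranspose, Matrix.conjTranspose_mul, frobenius_mul_left,
    Matrix.frobenius_norm_conjTranspose]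
  simpa using hU

/-- The `m × n` matrix with ones on its diagonal and zeros elsewhere. -/
def truncation (𝕜 : Type*) [RCLike 𝕜] (m n : ℕ) : Matrix (Fin m) (Fin n) 𝕜 :=
  Matrix.of fun i j => if (i : ℕ) = (j : ℕ) then 1 else 0

theorem truncation_conjTranspose (m n : ℕ) : (truncation 𝕜 m n)ᴴ = truncation 𝕜 n m := by
  ext i j
  simp [truncation, eq_comm, apply_ite (starRingEnd 𝕜)]

theorem mul_truncation_apply {m n : ℕ} {p : Type*} (M : Matrix p (Fin m) 𝕜) (i : p) (j : Fin n) :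
    (M * truncation 𝕜 m n) i j = if h : (j : ℕ) < m then M i ⟨j, h⟩ else 0 := by
  rw [Matrix.mul_apply]
  split_ifs with h
  · rw [Finset.sum_eq_single ⟨j, h⟩]
    · simp [truncation]
    · intro b _ hb
      have : (b : ℕ) ≠ j := fun hh => hb (Fin.ext hh)
      simp [truncation, this]
    · simp
  · refine Finset.sum_eq_zero fun b _ => ?_
    have : (b : ℕ) ≠ j := by have := b.2; omega
    simp [truncation, this]

theorem sum_mul_truncation_le {m n : ℕ} {p : Type*} (M : Matrix p (Fin m) 𝕜) (i : p) :
    ∑ j, ‖(M * truncation 𝕜 m n) i j‖ ^ 2 ≤ ∑ k, ‖M i k‖ ^ 2 := by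
  have h : ∀ j : Fin n, ‖(M * truncation 𝕜 m n) i j‖ ^ 2 =
      ∑ k : Fin m, if (k : ℕ) = j then ‖M i k‖ ^ 2 else 0 := by
    intro j
    rw [mul_truncation_apply]
    split_ifs with hj
    · rw [Finset.sum_eq_single ⟨j, hj⟩]
      · simp
      · intro b _ hb
        exact if_neg fun hh => hb (Fin.ext hh)
      · simp
    · rw [Finset.sum_eq_zero]
      · simp
      · intro b _
        exact if_neg (by have := b.2; omega)
  simp_rw [h]
  rw [Finset.sum_comm]
  refine Finset.sum_le_sum fun k _ => ?_
  by_cases hk : (k : ℕ) < n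
  · rw [Finset.sum_eq_single ⟨k, hk⟩]
    · simp
    · intro b _ hb
      exact if_neg fun hh => hb (Fin.ext hh.symm)
    · simp
  · rw [Finset.sum_eq_zero]
    · positivity
    · intro b _
      exact if_neg (by have := b.2; omega)

theorem frobenius_mul_truncation_le {m n : ℕ} {p : Type*} [Fintype p] (M : Matrix p (Fin m) 𝕜) :
    ‖M * truncation 𝕜 m n‖ ≤ ‖M‖ := by
  refine le_of_sq_le_sq ?_ (norm_nonneg _)
  rw [frobenius_sq, frobenius_sq]
  exact Finset.sum_le_sum fun i _ => sum_mul_truncation_le M i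

theorem sum_row_mul_right {p q r : Type*} [Fintype q] [Fintype r] [DecidableEq q]
    {U : Matrix q r 𝕜} (hU : U * Uᴴ = 1) (M : Matrix p q 𝕜) (i : p) :
    ∑ j, ‖(M * U) i j‖ ^ 2 = ∑ j, ‖M i j‖ ^ 2 := by
  have h := frobenius_mul_right hU (M.submatrix (fun _ : Unit => i) id)
  have h2 : ‖M.submatrix (fun _ : Unit => i) id * U‖ ^ 2 =
    ‖M.submatrix (fun _ : Unit => i) id‖ ^ 2 := by rw [h]
  simpa [frobenius_sq, Matrix.mul_apply] using h2

end Frobenius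

/-! ### Existence of singular value decompositions -/

section SVD

variable {𝕜 : Type*} [RCLike 𝕜] {m n : ℕ}

theorem singVal_nonneg (A : Matrix (Fin m) (Fin n) 𝕜) (i : ℕ) : 0 ≤ singVal A i :=
  LinearMap.singularValues_nonneg _ _

theorem singVal_antitone (A : Matrix (Fin m) (Fin n) 𝕜) : Antitone (singVal A) :=
  LinearMap.singularValues_antitone _

theorem singVal_of_cols_le (A : Matrix (Fin m) (Fin n) 𝕜) {i : ℕ} (hi : n ≤ i) :
    singVal A i = 0 :=
  LinearMap.singularValues_of_finrank_le _ (by simpa using hi)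

theorem singVal_of_rows_le (A : Matrix (Fin m) (Fin n) 𝕜) {i : ℕ} (hi : m ≤ i) :
    singVal A i = 0 := by
  refine (LinearMap.singularValues_eq_zero_iff_le_finrank_range _).mpr (le_trans ?_ hi)
  simpa using Submodule.finrank_le (LinearMap.range (Matrix.toEuclideanLin A))

/-- The coordinate matrix of an orthonormal basis, with the basis vectors as columns, is unitary. -/
theorem basisMatrix_mem_unitary {p : ℕ}
    (b : OrthonormalBasis (Fin p) 𝕜 (EuclideanSpace 𝕜 (Fin p))) :
    (Matrix.of fun i j => b j i) ∈ Matrix.unitaryGroup (Fin p) 𝕜 := by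
  have h := (EuclideanSpace.basisFun (Fin p) 𝕜).toMatrix_orthonormalBasis_mem_unitary b
  convert h using 1
  ext i j
  simp [Module.Basis.toMatrix_apply]

/-- Every matrix has a full singular value decomposition: `V` collects the eigenvectors of
`Aᴴ * A`, and `U` extends the normalized images of those with a positive eigenvalue. -/
theorem exists_isFullSVD (A : Matrix (Fin m) (Fin n) 𝕜) : ∃ U V, IsFullSVD A U V := by
  set T := Matrix.toEuclideanLin A with hT
  have hn : Module.finrank 𝕜 (EuclideanSpace 𝕜 (Fin n)) = n := by simp
  set b := T.isSymmetric_adjoint_comp_self.eigenvectorBasis hn with hb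
  have hbT : ∀ i j : Fin n, inner 𝕜 (T (b i)) (T (b j)) =
      if i = j then ((singVal A j ^ 2 : ℝ) : 𝕜) else 0 := by
    intro i j
    rw [← LinearMap.adjoint_inner_right]
    have h1 : (LinearMap.adjoint T) (T (b j)) = ((singVal A j ^ 2 : ℝ) : 𝕜) • b j := by
      have := T.isSymmetric_adjoint_comp_self.apply_eigenvectorBasis hn j
      rw [← LinearMap.sq_singularValues_fin] at this
      exact this
    rw [h1, inner_smul_right, orthonormal_iff_ite.mp b.orthonormal]
    simp
  let v : Fin m → EuclideanSpace 𝕜 (Fin m) := fun i =>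
    if h : (i : ℕ) < n then ((singVal A i : ℝ) : 𝕜)⁻¹ • T (b ⟨i, h⟩) else 0
  let s : Set (Fin m) := {i | singVal A i ≠ 0}
  have hs : ∀ i ∈ s, (i : ℕ) < n := fun i hi => by
    by_contra h
    exact hi (singVal_of_cols_le A (not_lt.mp h))
  have hv : Orthonormal 𝕜 (s.domRestrict v) := by
    rw [orthonormal_iff_ite]
    rintro ⟨i, hi⟩ ⟨j, hj⟩
    have h1 : ((singVal A i : ℝ) : 𝕜) ≠ 0 := by exact_mod_cast hi
    simp only [Set.domRestrict_apply, v, dif_pos (hs i hi), dif_pos (hs j hj), inner_smul_left,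
      inner_smul_right, hbT, Subtype.mk.injEq, Fin.mk.injEq, Fin.val_inj]
    split_ifs with hij
    · subst hij
      simp only [map_inv₀, RCLike.conj_ofReal, RCLike.ofReal_pow]
      field_simp
    · simp
  obtain ⟨u, hu⟩ := hv.exists_orthonormalBasis_extension_of_card_eq (by simp)
  refine ⟨Matrix.of fun i j => u j i, Matrix.of fun i j => b j i, basisMatrix_mem_unitary u,
    basisMatrix_mem_unitary b, ?_⟩
  have hV := basisMatrix_mem_unitary b
  set U : Matrix (Fin m) (Fin m) 𝕜 := Matrix.of fun i j => u j i with hU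
  set V : Matrix (Fin n) (Fin n) 𝕜 := Matrix.of fun i j => b j i with hVdef
  have key : A * V = U * singValMatrix A := by
    ext i j
    have h1 : (A * V) i j = T (b j) i := by
      simp [T, Matrix.mul_apply, V, Matrix.mulVec, dotProduct]
    rw [h1, Matrix.mul_apply]
    have hz : singVal A j = 0 → T (b j) = 0 := by
      intro h0
      have := hbT j j
      rw [h0] at this
      simpa using this
    by_cases hj : singVal A j = 0
    · rw [hz hj, Finset.sum_eq_zero]
      · simp
      · intro k _
        by_cases hk : (k : ℕ) = j <;> simp [singValMatrix, hk, hj]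
    · have hjm : (j : ℕ) < m := by
        by_contra h
        exact hj (singVal_of_rows_le A (not_lt.mp h))
      have hj' : ((singVal A j : ℝ) : 𝕜) ≠ 0 := by exact_mod_cast hj
      rw [Finset.sum_eq_single ⟨j, hjm⟩]
      · simp only [U, Matrix.of_apply, hu ⟨j, hjm⟩ hj, v, Fin.is_lt, dif_pos, singValMatrix]
        simp
        field_simp
      · intro k _ hk
        have : (k : ℕ) ≠ j := fun hh => hk (Fin.ext hh)
        simp [singValMatrix, this]
      · simp
  have hVV : V * Vᴴ = 1 := Matrix.mem_unitaryGroup_iff.mp hV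
  rw [← key, Matrix.mul_assoc, hVV, Matrix.mul_one]

end SVD

/-! ### Weyl's inequality and uniqueness of the singular values -/

section Weyl

variable {𝕜 : Type*} [RCLike 𝕜] {m n : ℕ}

/-- The `m × n` matrix with the numbers `d 0, d 1, …` on its diagonal and zeros elsewhere. -/
def rectDiag (𝕜 : Type*) [RCLike 𝕜] (m n : ℕ) (d : ℕ → ℝ) : Matrix (Fin m) (Fin n) 𝕜 :=
  Matrix.of fun i j => if (i : ℕ) = (j : ℕ) then (d i : 𝕜) else 0

theorem singValMatrix_eq_rectDiag (A : Matrix (Fin m) (Fin n) 𝕜) :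
    singValMatrix A = rectDiag 𝕜 m n (singVal A) := rfl

theorem rectDiag_eq_truncation_mul (d : ℕ → ℝ) :
    rectDiag 𝕜 m n d = truncation 𝕜 m n * Matrix.diagonal fun j : Fin n => ((d j : ℝ) : 𝕜) := by
  ext i j
  by_cases h : (i : ℕ) = j <;> simp [rectDiag, truncation, h]

theorem rectDiag_eq_mul_truncation (d : ℕ → ℝ) :
    rectDiag 𝕜 m n d = (Matrix.diagonal fun i : Fin m => ((d i : ℝ) : 𝕜)) * truncation 𝕜 m n := by
  ext i j
  by_cases h : (i : ℕ) = j <;> simp [rectDiag, truncation, h]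

theorem truncation_mul_apply {p : Type*} (M : Matrix (Fin n) p 𝕜) (i : Fin m) (j : p) :
    (truncation 𝕜 m n * M) i j = if h : (i : ℕ) < n then M ⟨i, h⟩ j else 0 := by
  have h1 := mul_truncation_apply (n := m) Mᴴ j i
  rw [← truncation_conjTranspose, ← Matrix.conjTranspose_mul, Matrix.conjTranspose_apply] at h1
  rw [← star_star ((truncation 𝕜 m n * M) i j), h1]
  split_ifs <;> simp

theorem frobenius_truncation_mul_le {p : Type*} [Fintype p] (M : Matrix (Fin n) p 𝕜) :
    ‖truncation 𝕜 m n * M‖ ≤ ‖M‖ := by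
  rw [← Matrix.frobenius_norm_conjTranspose, Matrix.conjTranspose_mul, truncation_conjTranspose,
    ← Matrix.frobenius_norm_conjTranspose M]
  exact frobenius_mul_truncation_le _

theorem frobenius_truncation_mul_eq {p : Type*} [Fintype p] (M : Matrix (Fin n) p 𝕜)
    (hM : ∀ i : Fin n, m ≤ i → ∀ j, M i j = 0) : ‖truncation 𝕜 m n * M‖ = ‖M‖ := by
  refine le_antisymm (frobenius_truncation_mul_le M) ?_
  have h : truncation 𝕜 n m * (truncation 𝕜 m n * M) = M := by
    ext i j
    rw [truncation_mul_apply]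
    split_ifs with h
    · rw [truncation_mul_apply, dif_pos i.2]
    · exact (hM i (not_lt.mp h) j).symm
  calc ‖M‖ = ‖truncation 𝕜 n m * (truncation 𝕜 m n * M)‖ := by rw [h]
    _ ≤ _ := frobenius_truncation_mul_le _

theorem frobenius_rectDiag_mul_le {d : ℕ → ℝ} (hd : Antitone d) (hd0 : ∀ i, 0 ≤ d i) {i : ℕ}
    {p : Type*} [Fintype p] (z : Matrix (Fin n) p 𝕜)
    (hz : ∀ l : Fin n, (l : ℕ) < i → ∀ k, z l k = 0) :
    ‖rectDiag 𝕜 m n d * z‖ ≤ d i * ‖z‖ := by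
  rw [rectDiag_eq_truncation_mul, Matrix.mul_assoc]
  refine (frobenius_truncation_mul_le _).trans ?_
  refine le_of_sq_le_sq ?_ (mul_nonneg (hd0 i) (norm_nonneg _))
  rw [mul_pow, frobenius_sq, frobenius_sq, Finset.mul_sum]
  refine Finset.sum_le_sum fun l _ => ?_
  rw [Finset.mul_sum]
  refine Finset.sum_le_sum fun k _ => ?_
  rw [Matrix.diagonal_mul, norm_mul, mul_pow]
  rcases lt_or_ge (l : ℕ) i with h | h
  · simp [hz l h]
  · rw [RCLike.norm_ofReal, sq_abs]
    exact mul_le_mul_of_nonneg_right (pow_le_pow_left₀ (hd0 _) (hd h) 2) (by positivity)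

theorem le_frobenius_rectDiag_mul {d : ℕ → ℝ} (hd : Antitone d) (hd0 : ∀ i, 0 ≤ d i) {i : ℕ}
    (him : i < m) {p : Type*} [Fintype p] (y : Matrix (Fin n) p 𝕜)
    (hy : ∀ l : Fin n, i < (l : ℕ) → ∀ k, y l k = 0) :
    d i * ‖y‖ ≤ ‖rectDiag 𝕜 m n d * y‖ := by
  rw [rectDiag_eq_truncation_mul, Matrix.mul_assoc, frobenius_truncation_mul_eq]
  · refine le_of_sq_le_sq ?_ (norm_nonneg _)
    rw [mul_pow, frobenius_sq, frobenius_sq, Finset.mul_sum]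
    refine Finset.sum_le_sum fun l _ => ?_
    rw [Finset.mul_sum]
    refine Finset.sum_le_sum fun k _ => ?_
    rw [Matrix.diagonal_mul, norm_mul, mul_pow]
    rcases lt_or_ge i (l : ℕ) with h | h
    · simp [hy l h]
    · rw [RCLike.norm_ofReal, sq_abs]
      exact mul_le_mul_of_nonneg_right (pow_le_pow_left₀ (hd0 _) (hd h) 2) (by positivity)
  · intro l hl k
    rw [Matrix.diagonal_mul, hy l (by omega) k, mul_zero]

/-- **Weyl's inequality** for singular values, for arbitrary decompositions with decreasing
diagonals. The span of the first `i + 1` columns of `V` meets the orthogonal complement of the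
first `i` columns of `V'` by a dimension count, and a common vector compares `d i` with `d' i`. -/
theorem weyl_of_decomposition {A A' : Matrix (Fin m) (Fin n) 𝕜} {U U' : Matrix (Fin m) (Fin m) 𝕜}
    {V V' : Matrix (Fin n) (Fin n) 𝕜} {d d' : ℕ → ℝ}
    (hU : U ∈ Matrix.unitaryGroup (Fin m) 𝕜) (hV : V ∈ Matrix.unitaryGroup (Fin n) 𝕜)
    (hU' : U' ∈ Matrix.unitaryGroup (Fin m) 𝕜) (hV' : V' ∈ Matrix.unitaryGroup (Fin n) 𝕜)
    (hd : Antitone d) (hd0 : ∀ i, 0 ≤ d i) (hd' : Antitone d') (hd0' : ∀ i, 0 ≤ d' i)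
    (hA : A = U * rectDiag 𝕜 m n d * Vᴴ) (hA' : A' = U' * rectDiag 𝕜 m n d' * V'ᴴ)
    {i : ℕ} (him : i < m) (hin : i < n) : d i ≤ d' i + ‖A - A'‖ := by
  rw [Matrix.mem_unitaryGroup_iff', Matrix.star_eq_conjTranspose] at hU hV hU'
  rw [Matrix.mem_unitaryGroup_iff, Matrix.star_eq_conjTranspose] at hV'
  obtain ⟨c, hc, hc0⟩ : ∃ c : Fin (i + 1) → 𝕜,
      (truncation 𝕜 i n * (V'ᴴ * V) * truncation 𝕜 n (i + 1)) *ᵥ c = 0 ∧ c ≠ 0 := by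
    have := LinearMap.ker_ne_bot_of_finrank_lt
      (f := Matrix.toLin' (truncation 𝕜 i n * (V'ᴴ * V) * truncation 𝕜 n (i + 1))) (by simp)
    obtain ⟨c, hc, hc0⟩ := Submodule.exists_mem_ne_zero_of_ne_bot this
    exact ⟨c, by rwa [LinearMap.mem_ker, Matrix.toLin'_apply] at hc, hc0⟩
  set y : Matrix (Fin n) Unit 𝕜 := truncation 𝕜 n (i + 1) * Matrix.replicateCol Unit c with hy
  set z : Matrix (Fin n) Unit 𝕜 := V'ᴴ * (V * y) with hz
  have hy0 : y ≠ 0 := by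
    intro h
    apply hc0
    ext k
    have h1 : y ⟨k, by have := k.2; omega⟩ () = 0 := by rw [h]; rfl
    rw [hy, truncation_mul_apply, dif_pos k.2] at h1
    simpa using h1
  have hz0 : ∀ l : Fin n, (l : ℕ) < i → ∀ k, z l k = 0 := by
    intro l hl k
    have h1 : truncation 𝕜 i n * z = 0 := by
      rw [hz, hy, ← Matrix.mul_assoc, ← Matrix.mul_assoc, ← Matrix.mul_assoc,
        Matrix.mul_assoc (truncation 𝕜 i n), ← Matrix.replicateCol_mulVec, hc]
      rfl
    have h2 : (truncation 𝕜 i n * z) ⟨l, hl⟩ k = 0 := by rw [h1]; rfl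
    rwa [truncation_mul_apply, dif_pos l.2] at h2
  have hysupp : ∀ l : Fin n, i < (l : ℕ) → ∀ k, y l k = 0 := by
    intro l hl k
    rw [hy, truncation_mul_apply, dif_neg (by omega)]
  have hzy : ‖z‖ = ‖y‖ := by
    rw [hz, frobenius_mul_left (by simpa using hV'), frobenius_mul_left hV]
  have h1 : ‖A * (V * y)‖ = ‖rectDiag 𝕜 m n d * y‖ := by
    rw [hA, Matrix.mul_assoc, ← Matrix.mul_assoc Vᴴ, hV, Matrix.one_mul, Matrix.mul_assoc,
      frobenius_mul_left hU]
  have h2 : ‖A' * (V * y)‖ = ‖rectDiag 𝕜 m n d' * z‖ := by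
    rw [hA', Matrix.mul_assoc, Matrix.mul_assoc, frobenius_mul_left hU']
  have h3 : ‖A * (V * y)‖ ≤ ‖A' * (V * y)‖ + ‖A - A'‖ * ‖y‖ := by
    have e : A * (V * y) = A' * (V * y) + (A - A') * (V * y) := by
      rw [← Matrix.add_mul, add_sub_cancel]
    calc ‖A * (V * y)‖ = ‖A' * (V * y) + (A - A') * (V * y)‖ := by rw [← e]
      _ ≤ ‖A' * (V * y)‖ + ‖(A - A') * (V * y)‖ := norm_add_le _ _
      _ ≤ ‖A' * (V * y)‖ + ‖A - A'‖ * ‖V * y‖ := by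
        gcongr
        exact Matrix.frobenius_norm_mul _ _
      _ = _ := by rw [frobenius_mul_left hV]
  have h4 : d i * ‖y‖ ≤ (d' i + ‖A - A'‖) * ‖y‖ := by
    calc d i * ‖y‖ ≤ ‖A * (V * y)‖ := by
          rw [h1]
          exact le_frobenius_rectDiag_mul hd hd0 him y hysupp
      _ ≤ ‖A' * (V * y)‖ + ‖A - A'‖ * ‖y‖ := h3
      _ ≤ d' i * ‖z‖ + ‖A - A'‖ * ‖y‖ := by
        rw [h2]
        gcongr
        exact frobenius_rectDiag_mul_le hd' hd0' z hz0
      _ = _ := by rw [hzy]; ring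
  exact le_of_mul_le_mul_right h4 (norm_pos_iff.mpr hy0)

/-- The diagonal of a singular value decomposition with a decreasing nonnegative diagonal is the
sequence of singular values. -/
theorem singVal_eq_of_decomposition {A : Matrix (Fin m) (Fin n) 𝕜} {U : Matrix (Fin m) (Fin m) 𝕜}
    {V : Matrix (Fin n) (Fin n) 𝕜} {d : ℕ → ℝ}
    (hU : U ∈ Matrix.unitaryGroup (Fin m) 𝕜) (hV : V ∈ Matrix.unitaryGroup (Fin n) 𝕜)
    (hd : Antitone d) (hd0 : ∀ i, 0 ≤ d i) (hdm : ∀ i, m ≤ i → d i = 0)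
    (hdn : ∀ i, n ≤ i → d i = 0)
    (hA : A = U * rectDiag 𝕜 m n d * Vᴴ) : singVal A = d := by
  obtain ⟨U', V', h⟩ := exists_isFullSVD A
  have hA' := h.eq_mul
  rw [singValMatrix_eq_rectDiag] at hA'
  ext i
  rcases le_or_gt m i with hm | hm
  · rw [singVal_of_rows_le A hm, hdm i hm]
  rcases le_or_gt n i with hn | hn
  · rw [singVal_of_cols_le A hn, hdn i hn]
  have h1 := weyl_of_decomposition hU hV h.left_unitary h.right_unitary hd hd0 (singVal_antitone A)
    (singVal_nonneg A) hA hA' hm hn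
  have h2 := weyl_of_decomposition h.left_unitary h.right_unitary hU hV (singVal_antitone A)
    (singVal_nonneg A) hd hd0 hA' hA hm hn
  simp only [sub_self, norm_zero, add_zero] at h1 h2
  exact le_antisymm h2 h1

theorem singVal_sub_le (A A' : Matrix (Fin m) (Fin n) 𝕜) (i : ℕ) :
    |singVal A i - singVal A' i| ≤ ‖A - A'‖ := by
  obtain ⟨U, V, h⟩ := exists_isFullSVD A
  obtain ⟨U', V', h'⟩ := exists_isFullSVD A'
  rcases le_or_gt m i with hm | hm
  · simp [singVal_of_rows_le _ hm]
  rcases le_or_gt n i with hn | hn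
  · simp [singVal_of_cols_le _ hn]
  have h1 := weyl_of_decomposition h.left_unitary h.right_unitary h'.left_unitary
    h'.right_unitary (singVal_antitone A) (singVal_nonneg A) (singVal_antitone A')
    (singVal_nonneg A') h.eq_mul h'.eq_mul hm hn
  have h2 := weyl_of_decomposition h'.left_unitary h'.right_unitary h.left_unitary
    h.right_unitary (singVal_antitone A') (singVal_nonneg A') (singVal_antitone A)
    (singVal_nonneg A) h'.eq_mul h.eq_mul hm hn
  rw [norm_sub_rev] at h2
  exact abs_sub_le_iff.mpr ⟨by linarith, by linarith⟩

/-- Multiplication by unitary matrices keeps the singular values and rotates the factors. -/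
theorem IsFullSVD.unitary_mul {A : Matrix (Fin m) (Fin n) 𝕜} {U : Matrix (Fin m) (Fin m) 𝕜}
    {V : Matrix (Fin n) (Fin n) 𝕜} (h : IsFullSVD A U V) {R : Matrix (Fin m) (Fin m) 𝕜}
    {S : Matrix (Fin n) (Fin n) 𝕜} (hR : R ∈ Matrix.unitaryGroup (Fin m) 𝕜)
    (hS : S ∈ Matrix.unitaryGroup (Fin n) 𝕜) :
    singVal (R * A * Sᴴ) = singVal A ∧ IsFullSVD (R * A * Sᴴ) (R * U) (S * V) := by
  have hRU := mul_mem hR h.left_unitary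
  have hSV := mul_mem hS h.right_unitary
  have e : R * A * Sᴴ = (R * U) * rectDiag 𝕜 m n (singVal A) * (S * V)ᴴ := by
    conv_lhs => rw [h.eq_mul, singValMatrix_eq_rectDiag]
    simp only [Matrix.conjTranspose_mul, Matrix.mul_assoc]
  have hs := singVal_eq_of_decomposition hRU hSV (singVal_antitone A) (singVal_nonneg A)
    (fun i => singVal_of_rows_le A) (fun i => singVal_of_cols_le A) e
  exact ⟨hs, hRU, hSV, by rw [singValMatrix_eq_rectDiag, hs]; exact e⟩

/-- A singular value decomposition of a real matrix is one over the complex numbers, so that the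
singular values do not depend on the field. -/
theorem singVal_map_ofReal (A : Matrix (Fin m) (Fin n) ℝ) :
    singVal (A.map (fun x : ℝ => (x : ℂ))) = singVal A := by
  obtain ⟨U, V, h⟩ := exists_isFullSVD A
  have hmap : ∀ {p : ℕ} {W : Matrix (Fin p) (Fin p) ℝ}, W ∈ Matrix.unitaryGroup (Fin p) ℝ →
      W.map (fun x : ℝ => (x : ℂ)) ∈ Matrix.unitaryGroup (Fin p) ℂ := by
    intro p W hW
    rw [Matrix.mem_unitaryGroup_iff] at hW ⊢
    have h1 := congrArg (fun M : Matrix (Fin p) (Fin p) ℝ => M.map (algebraMap ℝ ℂ)) hW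
    simp only [Matrix.map_mul, Matrix.map_one _ (map_zero _) (map_one _)] at h1
    rw [← h1]
    congr 1
    ext i j
    simp
  refine singVal_eq_of_decomposition (hmap h.left_unitary) (hmap h.right_unitary)
    (singVal_antitone A) (singVal_nonneg A) (fun i => singVal_of_rows_le A)
    (fun i => singVal_of_cols_le A) ?_
  have h1 := congrArg (fun M : Matrix (Fin m) (Fin n) ℝ => M.map (algebraMap ℝ ℂ)) h.eq_mul
  simp only [Matrix.map_mul] at h1
  refine h1.trans ?_
  congr 1
  · congr 1
    ext i j
    simp only [singValMatrix, rectDiag, Matrix.map_apply, Matrix.of_apply]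
    split_ifs <;> simp
  · ext i j
    simp

end Weyl

/-! ### The domain in terms of the singular values -/

section Domain

variable {𝕜 : Type*} [RCLike 𝕜] {m n : ℕ}

/-- The square diagonal matrix of the singular values, continued by zeros if there are more rows
than columns. -/
def sigmaDiag (A : Matrix (Fin m) (Fin n) 𝕜) : Matrix (Fin m) (Fin m) 𝕜 :=
  Matrix.diagonal fun i : Fin m => ((singVal A i : ℝ) : 𝕜)

/-- The right singular vectors that belong to the columns of `U`: the columns of `V`, cut off or
continued by zero columns to `m` columns. -/
def rightCols (m : ℕ) (V : Matrix (Fin n) (Fin n) 𝕜) : Matrix (Fin n) (Fin m) 𝕜 :=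
  V * truncation 𝕜 n m

theorem sigmaDiag_mul_truncation (A : Matrix (Fin m) (Fin n) 𝕜) :
    sigmaDiag A * (truncation 𝕜 m n * truncation 𝕜 n m) = sigmaDiag A := by
  ext i j
  rw [sigmaDiag, Matrix.diagonal_mul, truncation_mul_apply, Matrix.diagonal_apply]
  by_cases h : (i : ℕ) < n
  · simp [h, truncation, Fin.ext_iff]
  · simp [singVal_of_cols_le A (not_lt.mp h)]

theorem sigmaDiag_conjTranspose (A : Matrix (Fin m) (Fin n) 𝕜) :
    (sigmaDiag A)ᴴ = sigmaDiag A := by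
  simp [sigmaDiag, Matrix.diagonal_conjTranspose, Pi.star_def]

namespace IsFullSVD

variable {A : Matrix (Fin m) (Fin n) 𝕜} {U : Matrix (Fin m) (Fin m) 𝕜}
  {V : Matrix (Fin n) (Fin n) 𝕜}

theorem left_mul_conjTranspose (h : IsFullSVD A U V) : U * Uᴴ = 1 :=
  Matrix.mem_unitaryGroup_iff.mp h.left_unitary

theorem conjTranspose_mul_left (h : IsFullSVD A U V) : Uᴴ * U = 1 :=
  Matrix.mem_unitaryGroup_iff'.mp h.left_unitary

theorem right_mul_conjTranspose (h : IsFullSVD A U V) : V * Vᴴ = 1 :=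
  Matrix.mem_unitaryGroup_iff.mp h.right_unitary

theorem conjTranspose_mul_right (h : IsFullSVD A U V) : Vᴴ * V = 1 :=
  Matrix.mem_unitaryGroup_iff'.mp h.right_unitary

theorem mul_rightCols (h : IsFullSVD A U V) : A * rightCols m V = U * sigmaDiag A := by
  conv_lhs => rw [h.eq_mul, singValMatrix_eq_rectDiag, rectDiag_eq_mul_truncation, rightCols]
  rw [Matrix.mul_assoc, ← Matrix.mul_assoc Vᴴ, h.conjTranspose_mul_right, Matrix.one_mul,
    Matrix.mul_assoc, Matrix.mul_assoc]
  exact congrArg _ (sigmaDiag_mul_truncation A)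

theorem conjTranspose_mul (h : IsFullSVD A U V) : Aᴴ * U = rightCols m V * sigmaDiag A := by
  conv_lhs => rw [h.eq_mul, singValMatrix_eq_rectDiag, rectDiag_eq_mul_truncation]
  rw [Matrix.conjTranspose_mul, Matrix.conjTranspose_mul, Matrix.conjTranspose_mul,
    Matrix.conjTranspose_conjTranspose, truncation_conjTranspose, Matrix.mul_assoc,
    Matrix.mul_assoc, h.conjTranspose_mul_left, Matrix.mul_one, ← Matrix.mul_assoc, rightCols]
  exact congrArg _ (sigmaDiag_conjTranspose A)

theorem gram_mul (h : IsFullSVD A U V) : A * Aᴴ * U = U * (sigmaDiag A * sigmaDiag A) := by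
  rw [Matrix.mul_assoc, h.conjTranspose_mul, ← Matrix.mul_assoc, h.mul_rightCols, Matrix.mul_assoc]

theorem conjTranspose_mul_gram (h : IsFullSVD A U V) :
    Uᴴ * (A * Aᴴ) = sigmaDiag A * sigmaDiag A * Uᴴ := by
  have := congrArg Matrix.conjTranspose h.gram_mul
  simpa [Matrix.conjTranspose_mul, sigmaDiag_conjTranspose, Matrix.mul_assoc] using this

theorem col_mem_basicLeft (h : IsFullSVD A U V) (i : Fin m) :
    U.col i ∈ basicLeft A (singVal A i) := by
  rw [basicLeft, Module.End.mem_eigenspace_iff, Matrix.toLin'_apply]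
  ext k
  have := congrFun (congrFun h.gram_mul k) i
  rw [Matrix.mul_apply, sigmaDiag, Matrix.diagonal_mul_diagonal, Matrix.mul_diagonal] at this
  simp only [Matrix.mulVec, dotProduct, Matrix.col_apply, Pi.smul_apply, smul_eq_mul, this]
  push_cast
  ring

theorem coord_eq_zero_of_mem_basicLeft (h : IsFullSVD A U V) {s : ℝ} (hs : 0 ≤ s) {x : Fin m → 𝕜}
    (hx : x ∈ basicLeft A s) {l : Fin m} (hl : singVal A l ≠ s) : (Uᴴ *ᵥ x) l = 0 := by
  rw [basicLeft, Module.End.mem_eigenspace_iff, Matrix.toLin'_apply] at hx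
  have h1 := congrArg (fun v => (Uᴴ *ᵥ v) l) hx
  simp only [Matrix.mulVec_mulVec, h.conjTranspose_mul_gram, Matrix.mulVec_smul, Pi.smul_apply,
    smul_eq_mul] at h1
  rw [← Matrix.mulVec_mulVec, sigmaDiag, Matrix.diagonal_mul_diagonal, Matrix.mulVec_diagonal] at h1
  have h2 : ((singVal A l ^ 2 - s ^ 2 : ℝ) : 𝕜) * (Uᴴ *ᵥ x) l = 0 := by
    push_cast at h1 ⊢
    linear_combination h1
  refine (mul_eq_zero.mp h2).resolve_left ?_
  have h3 : singVal A l ^ 2 - s ^ 2 ≠ 0 := by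
    intro h4
    exact hl ((sq_eq_sq₀ (singVal_nonneg A l) hs).mp (by linarith))
  exact_mod_cast h3

theorem eq_sum_coord (h : IsFullSVD A U V) (x : Fin m → 𝕜) :
    x = ∑ l, (Uᴴ *ᵥ x) l • U.col l := by
  conv_lhs => rw [← Matrix.one_mulVec x, ← h.left_mul_conjTranspose, ← Matrix.mulVec_mulVec]
  ext k
  simp [Matrix.mulVec, dotProduct, mul_comm]

theorem coord_col (h : IsFullSVD A U V) (i l : Fin m) :
    (Uᴴ *ᵥ U.col i) l = if l = i then 1 else 0 := by
  have := congrFun (congrFun h.conjTranspose_mul_left l) i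
  rw [Matrix.one_apply, Matrix.mul_apply] at this
  exact this

end IsFullSVD

/-- The singular values at the positions in `π` differ from those at the other positions. -/
def Separated (π : Finset (Fin m)) (A : Matrix (Fin m) (Fin n) 𝕜) : Prop :=
  ∀ i ∈ π, ∀ j ∉ π, singVal A i ≠ singVal A j

theorem IsFullSVD.isLeftSingularSubspace_iff {π : Finset (Fin m)} {A : Matrix (Fin m) (Fin n) 𝕜}
    {U : Matrix (Fin m) (Fin m) 𝕜} {V : Matrix (Fin n) (Fin n) 𝕜} (h : IsFullSVD A U V) :
    IsLeftSingularSubspace A (colSpan U π) ↔ Separated π A := by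
  constructor
  · rintro ⟨S, hS, hW⟩ i hi j hj hij
    have hS0 : ∀ s ∈ S, 0 ≤ s := by
      intro s hs
      rcases hS hs with rfl | ⟨k, rfl⟩
      · exact le_rfl
      · exact singVal_nonneg A k
    -- if the `l`-th singular value is not in `S`, no element has a component along column `l`
    have hcoord : ∀ l : Fin m, singVal A l ∉ S → ∀ x ∈ colSpan U π, (Uᴴ *ᵥ x) l = 0 := by
      intro l hl x hx
      rw [hW] at hx
      have hle : ⨆ s ∈ S, basicLeft A s ≤
          LinearMap.ker ((LinearMap.proj l).comp (Matrix.toLin' Uᴴ)) := by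
        refine iSup₂_le fun s hs y hy => ?_
        simpa using h.coord_eq_zero_of_mem_basicLeft (hS0 s hs) hy
          (fun hh => hl (by rw [hh]; exact hs))
      simpa using hle hx
    have hiS : singVal A i ∈ S := by
      by_contra hn
      have := hcoord i hn (U.col i) (Submodule.subset_span ⟨i, hi, rfl⟩)
      rw [h.coord_col, if_pos rfl] at this
      exact one_ne_zero this
    have hjW : U.col j ∈ colSpan U π := by
      rw [hW]
      refine Submodule.mem_iSup_of_mem (singVal A j) (Submodule.mem_iSup_of_mem ?_ ?_)
      · rw [← hij]
        exact hiS
      · exact h.col_mem_basicLeft j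
    have hjc : ∀ x ∈ colSpan U π, (Uᴴ *ᵥ x) j = 0 := by
      intro x hx
      have hle : colSpan U π ≤ LinearMap.ker ((LinearMap.proj j).comp (Matrix.toLin' Uᴴ)) := by
        refine Submodule.span_le.mpr ?_
        rintro _ ⟨k, hk, rfl⟩
        have hkj : j ≠ k := fun hh => hj (by rw [hh]; exact hk)
        have := h.coord_col k j
        rw [if_neg hkj] at this
        simpa using this
      simpa using hle hx
    have := hjc _ hjW
    rw [h.coord_col, if_pos rfl] at this
    exact one_ne_zero this
  · intro hsep
    refine ⟨(fun i : Fin m => singVal A i) '' (π : Set (Fin m)), ?_, le_antisymm ?_ ?_⟩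
    · rintro _ ⟨i, _, rfl⟩
      exact Set.mem_insert_of_mem _ ⟨i, rfl⟩
    · refine Submodule.span_le.mpr ?_
      rintro _ ⟨i, hi, rfl⟩
      exact Submodule.mem_iSup_of_mem (singVal A i)
        (Submodule.mem_iSup_of_mem ⟨i, hi, rfl⟩ (h.col_mem_basicLeft i))
    · refine iSup₂_le fun s hs x hx => ?_
      obtain ⟨i, hi, rfl⟩ := hs
      rw [h.eq_sum_coord x]
      refine Submodule.sum_mem _ fun l _ => ?_
      by_cases hl : l ∈ π
      · exact Submodule.smul_mem _ _ (Submodule.subset_span ⟨l, hl, rfl⟩)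
      · rw [h.coord_eq_zero_of_mem_basicLeft (singVal_nonneg A i) hx (hsep i hi l hl).symm,
          zero_smul]
        exact Submodule.zero_mem _

theorem mem_domain_iff {π : Finset (Fin m)} {A : Matrix (Fin m) (Fin n) 𝕜} :
    A ∈ domain 𝕜 m n π ↔ Separated π A := by
  constructor
  · rintro ⟨U, V, h, hW⟩
    exact h.isLeftSingularSubspace_iff.mp hW
  · intro hsep
    obtain ⟨U, V, h⟩ := exists_isFullSVD A
    exact ⟨U, V, h, h.isLeftSingularSubspace_iff.mpr hsep⟩

end Domain

/-! ### Distances of subspaces and blocks of unitary matrices -/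

section Distances

variable {𝕜 : Type*} [RCLike 𝕜] {m n : ℕ}

/-- The coordinate projector onto the positions in `π`. -/
def coordProj (𝕜 : Type*) [RCLike 𝕜] {m : ℕ} (π : Finset (Fin m)) : Matrix (Fin m) (Fin m) 𝕜 :=
  Matrix.diagonal fun i => if i ∈ π then 1 else 0

/-- The norm of the block of `Uᴴ * U'` with rows outside and columns inside of `π`. For unitary
matrices it is the norm of the sines of the principal angles between the spans of the columns of
`U` and `U'` at the positions in `π`. -/
def sinNorm (π : Finset (Fin m)) (U U' : Matrix (Fin m) (Fin m) 𝕜) : ℝ :=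
  ‖coordProj 𝕜 πᶜ * (Uᴴ * U') * coordProj 𝕜 π‖

theorem sum_orderEmbOfFin {M : Type*} [AddCommMonoid M] (π : Finset (Fin m)) (f : Fin m → M) :
    ∑ a, f (π.orderEmbOfFin rfl a) = ∑ i ∈ π, f i := by
  conv_rhs => rw [← Finset.map_orderEmbOfFin_univ π rfl, Finset.sum_map]
  rfl

theorem selectCols_mul_conjTranspose (U : Matrix (Fin m) (Fin m) 𝕜) (π : Finset (Fin m)) :
    selectCols U π * (selectCols U π)ᴴ = U * coordProj 𝕜 π * Uᴴ := by
  ext i j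
  rw [Matrix.mul_apply, Matrix.mul_apply]
  simp only [selectCols, Matrix.submatrix_apply, Matrix.conjTranspose_apply, id, coordProj,
    Matrix.mul_diagonal]
  rw [sum_orderEmbOfFin π fun l => U i l * star (U j l)]
  simp [Finset.sum_ite_mem]

theorem frobenius_sq_coordProj_mul {p : Type*} [Fintype p] (π : Finset (Fin m))
    (M : Matrix (Fin m) p 𝕜) : ‖coordProj 𝕜 π * M‖ ^ 2 = ∑ i ∈ π, ∑ j, ‖M i j‖ ^ 2 := by
  rw [frobenius_sq, ← Finset.sum_subset (Finset.subset_univ π)]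
  · refine Finset.sum_congr rfl fun i hi => ?_
    simp [coordProj, Matrix.diagonal_mul, hi]
  · intro i _ hi
    simp [coordProj, Matrix.diagonal_mul, hi]

theorem sinNorm_sq (π : Finset (Fin m)) (U U' : Matrix (Fin m) (Fin m) 𝕜) :
    sinNorm π U U' ^ 2 = ∑ i ∈ πᶜ, ∑ j ∈ π, ‖(Uᴴ * U') i j‖ ^ 2 := by
  rw [sinNorm, Matrix.mul_assoc, frobenius_sq_coordProj_mul]
  refine Finset.sum_congr rfl fun i _ => ?_
  simp only [coordProj, Matrix.mul_diagonal, mul_ite, mul_one, mul_zero]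
  simp [apply_ite (fun x : 𝕜 => ‖x‖ ^ 2), Finset.sum_ite_mem]

theorem frobenius_sq_selectCols (π : Finset (Fin m)) (U U' : Matrix (Fin m) (Fin m) 𝕜) :
    ‖(selectCols U π)ᴴ * selectCols U' π‖ ^ 2 = ∑ i ∈ π, ∑ j ∈ π, ‖(Uᴴ * U') i j‖ ^ 2 := by
  rw [frobenius_sq, ← sum_orderEmbOfFin π]
  refine Finset.sum_congr rfl fun a _ => ?_
  rw [← sum_orderEmbOfFin π]
  rfl

theorem sinNorm_sq_eq_card_sub (π : Finset (Fin m)) {U U' : Matrix (Fin m) (Fin m) 𝕜}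
    (hU : U ∈ Matrix.unitaryGroup (Fin m) 𝕜) (hU' : U' ∈ Matrix.unitaryGroup (Fin m) 𝕜) :
    sinNorm π U U' ^ 2 = π.card - ‖(selectCols U π)ᴴ * selectCols U' π‖ ^ 2 := by
  rw [sinNorm_sq, frobenius_sq_selectCols, eq_sub_iff_add_eq, add_comm, Finset.sum_add_sum_compl,
    Finset.sum_comm]
  have hcol : ∀ j, ∑ i, ‖(Uᴴ * U') i j‖ ^ 2 = 1 := by
    intro j
    rw [Matrix.mem_unitaryGroup_iff, Matrix.star_eq_conjTranspose] at hU
    rw [Matrix.mem_unitaryGroup_iff', Matrix.star_eq_conjTranspose] at hU'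
    have h1 : (Uᴴ * U')ᴴ * (Uᴴ * U') = 1 := by
      rw [Matrix.conjTranspose_mul, Matrix.conjTranspose_conjTranspose, Matrix.mul_assoc,
        ← Matrix.mul_assoc U, hU, Matrix.one_mul, hU']
    have h2 := congrFun (congrFun h1 j) j
    rw [Matrix.mul_apply, Matrix.one_apply_eq] at h2
    simp only [Matrix.conjTranspose_apply, RCLike.star_def, RCLike.conj_mul] at h2
    exact_mod_cast h2
  simp [hcol]

/-- The norm of `Qᴴ * Q'` depends on the projectors only: its square is the trace of their
product. -/
theorem frobenius_frames_eq {p d : ℕ} {Q F Q' F' : Matrix (Fin p) (Fin d) 𝕜}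
    (h : Q * Qᴴ = F * Fᴴ) (h' : Q' * Q'ᴴ = F' * F'ᴴ) : ‖Qᴴ * Q'‖ ^ 2 = ‖Fᴴ * F'‖ ^ 2 := by
  have key : ∀ Q Q' : Matrix (Fin p) (Fin d) 𝕜,
      ((‖Qᴴ * Q'‖ ^ 2 : ℝ) : 𝕜) = ((Q * Qᴴ) * (Q' * Q'ᴴ)).trace := by
    intro Q Q'
    rw [frobenius_sq_eq_trace, Matrix.conjTranspose_mul, Matrix.conjTranspose_conjTranspose,
      ← Matrix.mul_assoc (Q * Qᴴ), Matrix.trace_mul_comm _ Q'ᴴ]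
    simp only [Matrix.mul_assoc]
  have h1 := key Q Q'
  rw [h, h', ← key F F'] at h1
  exact_mod_cast h1

theorem frobenius_conjTranspose_mul_le {p q r : Type*} [Fintype p] [Fintype q] [Fintype r]
    [DecidableEq q] {F : Matrix p q 𝕜} (hF : Fᴴ * F = 1) (M : Matrix p r 𝕜) :
    ‖Fᴴ * M‖ ≤ ‖M‖ := by
  refine le_of_sq_le_sq ?_ (norm_nonneg _)
  -- Pythagoras for the orthogonal projector `F * Fᴴ`
  have h : (‖M - F * (Fᴴ * M)‖ ^ 2 : ℝ) = ‖M‖ ^ 2 - ‖Fᴴ * M‖ ^ 2 := by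
    have h1 : ((‖M - F * (Fᴴ * M)‖ ^ 2 : ℝ) : 𝕜) = ((‖M‖ ^ 2 - ‖Fᴴ * M‖ ^ 2 : ℝ) : 𝕜) := by
      rw [RCLike.ofReal_sub, frobenius_sq_eq_trace, frobenius_sq_eq_trace, frobenius_sq_eq_trace,
        ← Matrix.trace_sub]
      congr 1
      have e : Mᴴ * (F * (Fᴴ * (F * (Fᴴ * M)))) = Mᴴ * (F * (Fᴴ * M)) := by
        rw [← Matrix.mul_assoc Fᴴ F, hF, Matrix.one_mul]
      simp only [Matrix.conjTranspose_sub, Matrix.conjTranspose_mul,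
        Matrix.conjTranspose_conjTranspose, Matrix.sub_mul, Matrix.mul_sub, Matrix.mul_assoc, e]
      abel
    exact_mod_cast h1
  nlinarith [sq_nonneg ‖M - F * (Fᴴ * M)‖]

theorem sum_singVal_sq {d : ℕ} (C : Matrix (Fin d) (Fin d) 𝕜) :
    ∑ i : Fin d, singVal C i ^ 2 = ‖C‖ ^ 2 := by
  obtain ⟨U, V, h⟩ := exists_isFullSVD C
  have h1 : ‖C‖ = ‖singValMatrix C‖ := by
    conv_lhs => rw [h.eq_mul]
    rw [frobenius_mul_right (by simpa using h.conjTranspose_mul_right),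
      frobenius_mul_left h.conjTranspose_mul_left]
  rw [h1, frobenius_sq]
  refine Finset.sum_congr rfl fun i _ => ?_
  rw [Finset.sum_eq_single i]
  · simp [singValMatrix]
  · intro j _ hj
    have : (i : ℕ) ≠ j := fun hh => hj (Fin.ext hh.symm)
    simp [singValMatrix, this]
  · simp

theorem singVal_frames_le_one {p d : ℕ} {F F' : Matrix (Fin p) (Fin d) 𝕜} (hF : Fᴴ * F = 1)
    (hF' : F'ᴴ * F' = 1) (i : Fin d) : singVal (Fᴴ * F') i ≤ 1 := by
  obtain ⟨U, V, h⟩ := exists_isFullSVD (Fᴴ * F')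
  -- the `i`-th singular value is the norm of `Fᴴ * F'` times the `i`-th column of `V`
  let e : Matrix (Fin d) Unit 𝕜 := Matrix.of fun j _ => if j = i then 1 else 0
  have he : ‖e‖ = 1 := by
    have : ‖e‖ ^ 2 = 1 := by
      rw [frobenius_sq]
      simp [e, apply_ite (fun x : 𝕜 => ‖x‖ ^ 2)]
    exact (pow_eq_one_iff_of_nonneg (norm_nonneg e) two_ne_zero).mp this
  have h1 := le_frobenius_rectDiag_mul (m := d) (singVal_antitone (Fᴴ * F'))
    (singVal_nonneg (Fᴴ * F')) i.2 e (fun l hl k => by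
      have : l ≠ i := fun hh => by rw [hh] at hl; exact lt_irrefl _ hl
      simp [e, this])
  have h2 : ‖rectDiag 𝕜 d d (singVal (Fᴴ * F')) * e‖ = ‖Fᴴ * F' * (V * e)‖ := by
    conv_rhs => rw [h.eq_mul]
    rw [Matrix.mul_assoc, ← Matrix.mul_assoc Vᴴ, h.conjTranspose_mul_right, Matrix.one_mul,
      Matrix.mul_assoc, frobenius_mul_left h.conjTranspose_mul_left, singValMatrix_eq_rectDiag]
  rw [h2, he, mul_one, Matrix.mul_assoc] at h1
  calc _ ≤ _ := h1
    _ ≤ ‖F' * (V * e)‖ := frobenius_conjTranspose_mul_le hF _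
    _ = 1 := by rw [frobenius_mul_left hF', frobenius_mul_left h.conjTranspose_mul_right, he]

namespace Gr

variable {d p : ℕ}

theorem frame_orthonormal (P : Gr 𝕜 d p) : P.frameᴴ * P.frame = 1 :=
  (Classical.choose_spec P.2).1

theorem eq_frame_mul (P : Gr 𝕜 d p) : P.1 = P.frame * P.frameᴴ :=
  (Classical.choose_spec P.2).2

/-- The chordal distance in terms of the unitary matrices whose columns span the subspaces. -/
theorem dist_chordal_eq_sinNorm {π : Finset (Fin m)} (P P' : Gr 𝕜 π.card m)
    {U U' : Matrix (Fin m) (Fin m) 𝕜} (hU : U ∈ Matrix.unitaryGroup (Fin m) 𝕜)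
    (hU' : U' ∈ Matrix.unitaryGroup (Fin m) 𝕜)
    (hP : P.1 = selectCols U π * (selectCols U π)ᴴ)
    (hP' : P'.1 = selectCols U' π * (selectCols U' π)ᴴ) :
    Gr.dist .chordal P P' = sinNorm π U U' := by
  have h0 : 0 ≤ sinNorm π U U' := norm_nonneg _
  rw [Gr.dist, ← Real.sqrt_sq h0, sinNorm_sq_eq_card_sub π hU hU']
  congr 1
  rw [frobenius_frames_eq (hP.symm.trans P.eq_frame_mul) (hP'.symm.trans P'.eq_frame_mul),
    ← sum_singVal_sq]
  have h1 : ∀ i, Real.sin (P.angle P' i) ^ 2 = 1 - singVal (P.frameᴴ * P'.frame) i ^ 2 := by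
    intro i
    have h0 := singVal_nonneg (P.frameᴴ * P'.frame) i
    have h1 := singVal_frames_le_one P.frame_orthonormal P'.frame_orthonormal i
    rw [Gr.angle, Real.sin_sq, Real.cos_arccos (by linarith) h1]
  simp [h1]

theorem angle_mem (P P' : Gr 𝕜 d p) (i : Fin d) : P.angle P' i ∈ Set.Icc 0 (Real.pi / 2) :=
  ⟨Real.arccos_nonneg _, Real.arccos_le_pi_div_two.mpr (singVal_nonneg _ _)⟩

/-- The function of a principal angle that enters the distance `δ`. -/
def distFun : GrDistance → ℝ → ℝ
  | .chordal, θ => Real.sin θ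
  | .grassmann, θ => θ
  | .procrustes, θ => 2 * Real.sin (θ / 2)

theorem dist_eq (δ : GrDistance) (P P' : Gr 𝕜 d p) :
    Gr.dist δ P P' = Real.sqrt (∑ i, distFun δ (P.angle P' i) ^ 2) := by
  cases δ <;> rfl

theorem sin_le_distFun (δ : GrDistance) {θ : ℝ} (hθ : θ ∈ Set.Icc 0 (Real.pi / 2)) :
    Real.sin θ ≤ distFun δ θ := by
  have hpi := Real.pi_pos
  cases δ with
  | chordal => exact le_rfl
  | grassmann => exact Real.sin_le hθ.1
  | procrustes =>
    have h1 : Real.sin θ = 2 * Real.sin (θ / 2) * Real.cos (θ / 2) := by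
      rw [← Real.sin_two_mul]
      ring_nf
    have h2 : 0 ≤ Real.sin (θ / 2) :=
      Real.sin_nonneg_of_nonneg_of_le_pi (by linarith [hθ.1]) (by linarith [hθ.2])
    rw [h1]
    exact mul_le_of_le_one_right (by positivity) (Real.cos_le_one _)

theorem distFun_le (δ : GrDistance) {θ : ℝ} (hθ : 0 ≤ θ) : distFun δ θ ≤ θ := by
  cases δ with
  | chordal => exact Real.sin_le hθ
  | grassmann => exact le_rfl
  | procrustes =>
    have := Real.sin_le (x := θ / 2) (by linarith)
    simp only [distFun]
    linarith

theorem dist_chordal_le (δ : GrDistance) (P P' : Gr 𝕜 d p) :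
    Gr.dist .chordal P P' ≤ Gr.dist δ P P' := by
  rw [dist_eq, dist_eq]
  refine Real.sqrt_le_sqrt (Finset.sum_le_sum fun i _ => ?_)
  have h := angle_mem P P' i
  exact pow_le_pow_left₀ (Real.sin_nonneg_of_nonneg_of_le_pi h.1 (by linarith [h.2, Real.pi_pos]))
    (sin_le_distFun δ h) 2

/-- All three distances agree to first order, by `θ ≤ tan θ`. -/
theorem dist_le_of_chordal_lt_one (δ : GrDistance) (P P' : Gr 𝕜 d p)
    (h1 : Gr.dist .chordal P P' < 1) :
    Gr.dist δ P P' ≤ Gr.dist .chordal P P' / Real.sqrt (1 - Gr.dist .chordal P P' ^ 2) := by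
  set c := Gr.dist .chordal P P' with hc
  have hc0 : 0 ≤ c := Real.sqrt_nonneg _
  have hpos : 0 < 1 - c ^ 2 := by nlinarith
  have hcsq : c ^ 2 = ∑ i, Real.sin (P.angle P' i) ^ 2 :=
    Real.sq_sqrt (Finset.sum_nonneg fun _ _ => sq_nonneg _)
  have hterm : ∀ i, distFun δ (P.angle P' i) ^ 2 ≤ Real.sin (P.angle P' i) ^ 2 / (1 - c ^ 2) := by
    intro i
    have hθ := angle_mem P P' i
    set θ := P.angle P' i with hθdef
    have hsin : 0 ≤ Real.sin θ :=
      Real.sin_nonneg_of_nonneg_of_le_pi hθ.1 (by linarith [hθ.2, Real.pi_pos])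
    have hcos : 1 - c ^ 2 ≤ Real.cos θ ^ 2 := by
      rw [Real.cos_sq', hcsq]
      have := Finset.single_le_sum (f := fun i => Real.sin (P.angle P' i) ^ 2)
        (fun _ _ => sq_nonneg _) (Finset.mem_univ i)
      simp only [← hθdef] at this
      linarith
    have hcos0 : 0 ≤ Real.cos θ :=
      Real.cos_nonneg_of_mem_Icc ⟨by linarith [hθ.1, Real.pi_pos], hθ.2⟩
    have htan : θ * Real.cos θ ≤ Real.sin θ := by
      rcases hθ.2.lt_or_eq with h | h
      · have hc' : 0 < Real.cos θ :=
          Real.cos_pos_of_mem_Ioo ⟨by linarith [hθ.1, Real.pi_pos], h⟩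
        have := Real.le_tan hθ.1 h
        rwa [Real.tan_eq_sin_div_cos, le_div_iff₀ hc'] at this
      · rw [h, Real.cos_pi_div_two, mul_zero, Real.sin_pi_div_two]
        exact zero_le_one
    rw [le_div_iff₀ hpos]
    calc distFun δ θ ^ 2 * (1 - c ^ 2) ≤ θ ^ 2 * Real.cos θ ^ 2 := by
          refine mul_le_mul (pow_le_pow_left₀ (hsin.trans (sin_le_distFun δ hθ))
            (distFun_le δ hθ.1) 2) hcos hpos.le (sq_nonneg _)
      _ = (θ * Real.cos θ) ^ 2 := by ring
      _ ≤ Real.sin θ ^ 2 := pow_le_pow_left₀ (mul_nonneg hθ.1 hcos0) htan 2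
  rw [dist_eq, Real.sqrt_le_left (by positivity), div_pow, Real.sq_sqrt hpos.le]
  nth_rewrite 1 [hcsq]
  rw [Finset.sum_div]
  exact Finset.sum_le_sum fun i _ => hterm i

end Gr

end Distances

/-! ### The perturbation of a singular subspace -/

section Perturbation

variable {𝕜 : Type*} [RCLike 𝕜] {m n : ℕ}

/-- The contribution of a pair of distinct singular values to the condition number. -/
def gapFun (a b : ℝ) : ℝ := Real.sqrt (a ^ 2 + b ^ 2) / |a ^ 2 - b ^ 2|

theorem gapFun_nonneg (a b : ℝ) : 0 ≤ gapFun a b := by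
  unfold gapFun
  positivity

/-- The exact perturbation identity: up to the differences of the eigenvalues, the entries of
`Uᴴ * U'` are combinations of the entries of the perturbation `A' - A` in singular bases. -/
theorem IsFullSVD.perturbation_identity {A A' : Matrix (Fin m) (Fin n) 𝕜}
    {U U' : Matrix (Fin m) (Fin m) 𝕜} {V V' : Matrix (Fin n) (Fin n) 𝕜}
    (h : IsFullSVD A U V) (h' : IsFullSVD A' U' V') (i j : Fin m) :
    (Uᴴ * (A' - A) * rightCols m V') i j * singVal A' j +
        singVal A i * ((rightCols m V)ᴴ * (A' - A)ᴴ * U') i j =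
      (Uᴴ * U') i j * (((singVal A' j ^ 2 - singVal A i ^ 2 : ℝ)) : 𝕜) := by
  have e1 : Uᴴ * (A' - A) * rightCols m V' =
      Uᴴ * U' * sigmaDiag A' - sigmaDiag A * ((rightCols m V)ᴴ * rightCols m V') := by
    have h1 := congrArg Matrix.conjTranspose h.conjTranspose_mul
    rw [Matrix.conjTranspose_mul, Matrix.conjTranspose_conjTranspose, Matrix.conjTranspose_mul,
      sigmaDiag_conjTranspose] at h1
    rw [Matrix.mul_sub, Matrix.sub_mul, h1, Matrix.mul_assoc, h'.mul_rightCols, Matrix.mul_assoc,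
      Matrix.mul_assoc]
  have e2 : (rightCols m V)ᴴ * (A' - A)ᴴ * U' =
      (rightCols m V)ᴴ * rightCols m V' * sigmaDiag A' - sigmaDiag A * (Uᴴ * U') := by
    have h1 := congrArg Matrix.conjTranspose h.mul_rightCols
    rw [Matrix.conjTranspose_mul, Matrix.conjTranspose_mul, sigmaDiag_conjTranspose] at h1
    rw [Matrix.conjTranspose_sub, Matrix.mul_sub, Matrix.sub_mul, h1, Matrix.mul_assoc,
      h'.conjTranspose_mul, Matrix.mul_assoc, Matrix.mul_assoc]
  rw [e1, e2]
  simp only [Matrix.sub_apply, sigmaDiag, Matrix.mul_diagonal, Matrix.diagonal_mul]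
  push_cast
  ring

/-- The left singular vectors at the positions in `π` span the same subspace for all singular value
decompositions of a matrix in the domain. -/
theorem projector_unique {π : Finset (Fin m)} {A : Matrix (Fin m) (Fin n) 𝕜} (hA : Separated π A)
    {U U' : Matrix (Fin m) (Fin m) 𝕜} {V V' : Matrix (Fin n) (Fin n) 𝕜}
    (h : IsFullSVD A U V) (h' : IsFullSVD A U' V') :
    selectCols U π * (selectCols U π)ᴴ = selectCols U' π * (selectCols U' π)ᴴ := by
  have hzero : ∀ i j : Fin m, singVal A i ≠ singVal A j → (Uᴴ * U') i j = 0 := by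
    intro i j hij
    have h1 := h.perturbation_identity h' i j
    simp only [sub_self, Matrix.mul_zero, Matrix.zero_mul, Matrix.conjTranspose_zero,
      Matrix.zero_apply, zero_mul, mul_zero, add_zero] at h1
    refine (mul_eq_zero.mp h1.symm).resolve_right ?_
    have : singVal A j ^ 2 - singVal A i ^ 2 ≠ 0 := fun h2 =>
      hij ((sq_eq_sq₀ (singVal_nonneg A i) (singVal_nonneg A j)).mp (by linarith))
    exact_mod_cast this
  have hcomm : coordProj 𝕜 π * (Uᴴ * U') = Uᴴ * U' * coordProj 𝕜 π := by
    ext i j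
    rw [coordProj, Matrix.diagonal_mul, Matrix.mul_diagonal]
    by_cases hi : i ∈ π <;> by_cases hj : j ∈ π
    · simp [hi, hj]
    · simp [hzero i j (hA i hi j hj)]
    · simp [hzero i j (hA j hj i hi).symm]
    · simp [hi, hj]
  rw [selectCols_mul_conjTranspose, selectCols_mul_conjTranspose]
  calc U * coordProj 𝕜 π * Uᴴ = U * coordProj 𝕜 π * Uᴴ * (U' * U'ᴴ) := by
        rw [h'.left_mul_conjTranspose, Matrix.mul_one]
    _ = U * (coordProj 𝕜 π * (Uᴴ * U')) * U'ᴴ := by simp only [Matrix.mul_assoc]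
    _ = (U * Uᴴ) * (U' * coordProj 𝕜 π * U'ᴴ) := by rw [hcomm]; simp only [Matrix.mul_assoc]
    _ = _ := by rw [h.left_mul_conjTranspose, Matrix.one_mul]

theorem leftMap_eq {π : Finset (Fin m)} (A : domain 𝕜 m n π) {U : Matrix (Fin m) (Fin m) 𝕜}
    {V : Matrix (Fin n) (Fin n) 𝕜} (h : IsFullSVD (A : Matrix (Fin m) (Fin n) 𝕜) U V) :
    (leftMap 𝕜 m n π A).1 = selectCols U π * (selectCols U π)ᴴ := by
  obtain ⟨V', h', -⟩ := leftFactor_spec A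
  exact projector_unique (mem_domain_iff.mp A.2) h' h

/-- The chordal distance of two values of `leftMap`, computed from any singular value
decompositions. -/
theorem dist_chordal_leftMap {π : Finset (Fin m)} (A A' : domain 𝕜 m n π)
    {U U' : Matrix (Fin m) (Fin m) 𝕜} {V V' : Matrix (Fin n) (Fin n) 𝕜}
    (h : IsFullSVD (A : Matrix (Fin m) (Fin n) 𝕜) U V)
    (h' : IsFullSVD (A' : Matrix (Fin m) (Fin n) 𝕜) U' V') :
    Gr.dist .chordal (leftMap 𝕜 m n π A) (leftMap 𝕜 m n π A') = sinNorm π U U' :=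
  Gr.dist_chordal_eq_sinNorm _ _ h.left_unitary h'.left_unitary (leftMap_eq A h) (leftMap_eq A' h')

theorem sum_mul_rightCols_le {V : Matrix (Fin n) (Fin n) 𝕜} (hV : V * Vᴴ = 1) {p : Type*}
    (M : Matrix p (Fin n) 𝕜) (i : p) :
    ∑ j, ‖(M * rightCols m V) i j‖ ^ 2 ≤ ∑ k, ‖M i k‖ ^ 2 := by
  rw [rightCols, ← Matrix.mul_assoc, ← sum_row_mul_right hV M i]
  exact sum_mul_truncation_le (M * V) i

theorem sq_norm_le_of_mul_add_mul_eq {f g x : 𝕜} {a b : ℝ} (ha : 0 ≤ a) (hb : 0 ≤ b) (hab : a ≠ b)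
    (h : f * b + a * g = x * (((b ^ 2 - a ^ 2 : ℝ)) : 𝕜)) :
    ‖x‖ ^ 2 ≤ gapFun a b ^ 2 * (‖f‖ ^ 2 + ‖g‖ ^ 2) := by
  have hne : a ^ 2 - b ^ 2 ≠ 0 := fun h0 => hab ((sq_eq_sq₀ ha hb).mp (by linarith))
  have hpos : 0 < (a ^ 2 - b ^ 2) ^ 2 := by positivity
  have h1 : ‖x‖ * |b ^ 2 - a ^ 2| ≤ ‖f‖ * b + a * ‖g‖ := by
    calc ‖x‖ * |b ^ 2 - a ^ 2| = ‖f * b + a * g‖ := by rw [h, norm_mul, RCLike.norm_ofReal]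
      _ ≤ ‖f * b‖ + ‖a * g‖ := norm_add_le _ _
      _ = _ := by
        rw [norm_mul, norm_mul, RCLike.norm_ofReal, RCLike.norm_ofReal, abs_of_nonneg ha,
          abs_of_nonneg hb]
  have h2 : (‖x‖ * |b ^ 2 - a ^ 2|) ^ 2 ≤ (‖f‖ * b + a * ‖g‖) ^ 2 :=
    pow_le_pow_left₀ (by positivity) h1 2
  rw [mul_pow, sq_abs] at h2
  -- Cauchy–Schwarz, with the defect as the square below
  rw [gapFun, div_pow, Real.sq_sqrt (by positivity), sq_abs, div_mul_eq_mul_div, le_div_iff₀ hpos]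
  nlinarith [sq_nonneg (‖f‖ * a - b * ‖g‖)]

theorem frobenius_coordProj_mul_le {p : Type*} [Fintype p] (π : Finset (Fin m))
    (M : Matrix (Fin m) p 𝕜) : ‖coordProj 𝕜 π * M‖ ≤ ‖M‖ := by
  refine le_of_sq_le_sq ?_ (norm_nonneg _)
  rw [frobenius_sq_coordProj_mul, frobenius_sq]
  exact Finset.sum_le_sum_of_subset_of_nonneg (Finset.subset_univ _) fun _ _ _ => by positivity

theorem frobenius_sq_coordProj_add {p : Type*} [Fintype p] (π : Finset (Fin m))
    (M : Matrix (Fin m) p 𝕜) :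
    ‖coordProj 𝕜 π * M‖ ^ 2 + ‖coordProj 𝕜 πᶜ * M‖ ^ 2 = ‖M‖ ^ 2 := by
  rw [frobenius_sq_coordProj_mul, frobenius_sq_coordProj_mul, Finset.sum_add_sum_compl,
    frobenius_sq]

theorem coordProj_add_compl (π : Finset (Fin m)) : coordProj 𝕜 π + coordProj 𝕜 πᶜ = 1 := by
  rw [coordProj, coordProj, Matrix.diagonal_add, ← Matrix.diagonal_one]
  congr 1
  ext i
  by_cases hi : i ∈ π <;> simp [hi]

theorem coordProj_conjTranspose (π : Finset (Fin m)) :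
    (coordProj 𝕜 π)ᴴ = coordProj 𝕜 π := by
  rw [coordProj, Matrix.diagonal_conjTranspose]
  congr 1
  ext i
  by_cases hi : i ∈ π <;> simp [hi]

/-- Passing from `U` to `U'` changes the selected part of the perturbation `E` by a higher order
term only. -/
theorem frobenius_selected_le (π : Finset (Fin m)) {U U' : Matrix (Fin m) (Fin m) 𝕜}
    (hU : U ∈ Matrix.unitaryGroup (Fin m) 𝕜) (hU' : U' ∈ Matrix.unitaryGroup (Fin m) 𝕜)
    (E : Matrix (Fin m) (Fin n) 𝕜) :
    ‖coordProj 𝕜 π * (U'ᴴ * E)‖ ≤ ‖coordProj 𝕜 π * (Uᴴ * E)‖ + sinNorm π U U' * ‖E‖ := by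
  rw [Matrix.mem_unitaryGroup_iff, Matrix.star_eq_conjTranspose] at hU hU'
  have hU2 : Uᴴ * U = 1 := mul_eq_one_comm.mp hU
  have e : coordProj 𝕜 π * (U'ᴴ * E) =
      coordProj 𝕜 π * (U'ᴴ * (U * (coordProj 𝕜 π * (Uᴴ * E)))) +
        (coordProj 𝕜 πᶜ * (Uᴴ * U') * coordProj 𝕜 π)ᴴ * (Uᴴ * E) := by
    have h1 : U'ᴴ * E = U'ᴴ * (U * ((coordProj 𝕜 π + coordProj 𝕜 πᶜ) * (Uᴴ * E))) := by
      rw [coordProj_add_compl, Matrix.one_mul, ← Matrix.mul_assoc U, hU, Matrix.one_mul]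
    rw [h1]
    simp only [Matrix.conjTranspose_mul, Matrix.conjTranspose_conjTranspose,
      coordProj_conjTranspose, Matrix.add_mul, Matrix.mul_add, Matrix.mul_assoc]
  rw [e]
  refine (norm_add_le _ _).trans (add_le_add ?_ ?_)
  · refine (frobenius_coordProj_mul_le _ _).trans ?_
    rw [frobenius_mul_left (by simpa using hU'), frobenius_mul_left hU2]
  · refine (Matrix.frobenius_norm_mul _ _).trans ?_
    rw [Matrix.frobenius_norm_conjTranspose,
      frobenius_mul_left (U := Uᴴ) (by rwa [Matrix.conjTranspose_conjTranspose]) E]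
    exact le_rfl

/-- The two blocks of the perturbation that move the subspace lie in complementary rows, so that
together they cost no more than the perturbation itself, up to a higher order term. -/
theorem sinNorm_le {π : Finset (Fin m)} {A A' : Matrix (Fin m) (Fin n) 𝕜}
    {U U' : Matrix (Fin m) (Fin m) 𝕜} {V V' : Matrix (Fin n) (Fin n) 𝕜}
    (h : IsFullSVD A U V) (h' : IsFullSVD A' U' V') {K : ℝ} (hK : 0 ≤ K)
    (hne : ∀ i ∉ π, ∀ j ∈ π, singVal A i ≠ singVal A' j)
    (hgap : ∀ i ∉ π, ∀ j ∈ π, gapFun (singVal A i) (singVal A' j) ≤ K) :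
    sinNorm π U U' ≤ K * ((1 + sinNorm π U U') * ‖A' - A‖) := by
  set E := A' - A with hE
  have hη : 0 ≤ sinNorm π U U' := norm_nonneg _
  set η := sinNorm π U U' with hηdef
  have hf : ∑ i ∈ πᶜ, ∑ j ∈ π, ‖(Uᴴ * E * rightCols m V') i j‖ ^ 2 ≤
      ‖coordProj 𝕜 πᶜ * (Uᴴ * E)‖ ^ 2 := by
    rw [frobenius_sq_coordProj_mul]
    refine Finset.sum_le_sum fun i _ => ?_
    exact (Finset.sum_le_sum_of_subset_of_nonneg (Finset.subset_univ _)
      fun _ _ _ => by positivity).trans (sum_mul_rightCols_le h'.right_mul_conjTranspose _ i)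
  have hg : ∑ i ∈ πᶜ, ∑ j ∈ π, ‖((rightCols m V)ᴴ * Eᴴ * U') i j‖ ^ 2 ≤
      ‖coordProj 𝕜 π * (U'ᴴ * E)‖ ^ 2 := by
    rw [frobenius_sq_coordProj_mul, Finset.sum_comm]
    refine Finset.sum_le_sum fun j _ => ?_
    have e : ∀ i, ‖((rightCols m V)ᴴ * Eᴴ * U') i j‖ = ‖(U'ᴴ * E * rightCols m V) j i‖ := by
      intro i
      rw [← norm_star, ← Matrix.conjTranspose_apply]
      simp only [Matrix.conjTranspose_mul, Matrix.conjTranspose_conjTranspose, Matrix.mul_assoc]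
    simp_rw [e]
    exact (Finset.sum_le_sum_of_subset_of_nonneg (Finset.subset_univ _)
      fun _ _ _ => by positivity).trans (sum_mul_rightCols_le h.right_mul_conjTranspose _ j)
  have hx : η ^ 2 ≤ K ^ 2 *
      (‖coordProj 𝕜 πᶜ * (Uᴴ * E)‖ ^ 2 + ‖coordProj 𝕜 π * (U'ᴴ * E)‖ ^ 2) := by
    refine le_trans ?_ (mul_le_mul_of_nonneg_left (add_le_add hf hg) (sq_nonneg K))
    rw [hηdef, sinNorm_sq, ← Finset.sum_add_distrib, Finset.mul_sum]
    refine Finset.sum_le_sum fun i hi => ?_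
    rw [← Finset.sum_add_distrib, Finset.mul_sum]
    refine Finset.sum_le_sum fun j hj => ?_
    have hi' : i ∉ π := Finset.mem_compl.mp hi
    refine (sq_norm_le_of_mul_add_mul_eq (singVal_nonneg A i) (singVal_nonneg A' j)
      (hne i hi' j hj) (h.perturbation_identity h' i j)).trans ?_
    exact mul_le_mul_of_nonneg_right
      (pow_le_pow_left₀ (gapFun_nonneg _ _) (hgap i hi' j hj) 2) (by positivity)
  have hsel := frobenius_selected_le π h.left_unitary h'.left_unitary E
  have hsum := frobenius_sq_coordProj_add π (Uᴴ * E)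
  have hpart := frobenius_coordProj_mul_le π (Uᴴ * E)
  have hUE : ‖Uᴴ * E‖ = ‖E‖ := frobenius_mul_left
    (by rw [Matrix.conjTranspose_conjTranspose, h.left_mul_conjTranspose]) E
  rw [hUE] at hsum hpart
  rw [← hηdef] at hsel
  have htot : ‖coordProj 𝕜 πᶜ * (Uᴴ * E)‖ ^ 2 + ‖coordProj 𝕜 π * (U'ᴴ * E)‖ ^ 2 ≤
      ((1 + η) * ‖E‖) ^ 2 := by
    have h1 := pow_le_pow_left₀ (norm_nonneg _) hsel 2
    have h2 : η * ‖E‖ * ‖coordProj 𝕜 π * (Uᴴ * E)‖ ≤ η * ‖E‖ * ‖E‖ :=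
      mul_le_mul_of_nonneg_left hpart (by positivity)
    nlinarith
  refine le_of_sq_le_sq ?_ (by positivity)
  rw [mul_pow]
  exact hx.trans (mul_le_mul_of_nonneg_left htot (sq_nonneg K))

end Perturbation

/-! ### The upper bound -/

section UpperBound

variable {𝕜 : Type*} [RCLike 𝕜] {m n : ℕ}

/-- The closed form of the condition number on the domain; it is `0` if `π` is empty or full. -/
def condFormula (π : Finset (Fin m)) (A : Matrix (Fin m) (Fin n) 𝕜) : ℝ≥0∞ :=
  ⨆ i ∈ π, ⨆ j ∈ πᶜ, ENNReal.ofReal (gapFun (singVal A i) (singVal A j))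

theorem gapFun_comm (a b : ℝ) : gapFun a b = gapFun b a := by
  rw [gapFun, gapFun, add_comm, abs_sub_comm]

theorem continuousAt_gapFun {a b : ℝ} (ha : 0 ≤ a) (hb : 0 ≤ b) (hab : a ≠ b) :
    ContinuousAt (gapFun a) b := by
  have hne : |a ^ 2 - b ^ 2| ≠ 0 :=
    abs_ne_zero.mpr fun h0 => hab ((sq_eq_sq₀ ha hb).mp (by linarith))
  unfold gapFun
  exact ContinuousAt.div (by fun_prop) (by fun_prop) hne

theorem eventually_gapFun_le {a b K : ℝ} (ha : 0 ≤ a) (hb : 0 ≤ b) (hab : a ≠ b)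
    (hK : gapFun a b < K) :
    ∀ᶠ e in 𝓝[>] (0 : ℝ), ∀ b', |b' - b| ≤ e → a ≠ b' ∧ gapFun a b' ≤ K := by
  have h1 : ∀ᶠ b' in 𝓝 b, a ≠ b' ∧ gapFun a b' ≤ K :=
    (isOpen_ne.eventually_mem hab.symm |>.mono fun _ h => h.symm).and
      (((continuousAt_gapFun ha hb hab).eventually_lt_const hK).mono fun _ h => h.le)
  obtain ⟨ε, hε, h2⟩ := Metric.eventually_nhds_iff.mp h1
  filter_upwards [Ioo_mem_nhdsGT hε] with e he b' hb'
  exact h2 (lt_of_le_of_lt (by rwa [Real.dist_eq]) he.2)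

/-- The estimate `c ≤ K * (1 + c) * e` gives `c ≤ x` with `x = K * e / (1 - K * e)`, and the bound
`x / √(1 - x ^ 2)` for the distances is `K * e` to first order. -/
theorem eventually_tan_bound {K K' : ℝ} (hKK' : K < K') :
    ∀ᶠ e in 𝓝[>] (0 : ℝ), K * e < 1 ∧ K * e / (1 - K * e) < 1 ∧
      K * e / (1 - K * e) / Real.sqrt (1 - (K * e / (1 - K * e)) ^ 2) ≤ K' * e := by
  have c0 : ContinuousAt (fun e : ℝ => K * e) 0 := by fun_prop
  have c1 : ContinuousAt (fun e : ℝ => 1 - K * e) 0 := by fun_prop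
  have c2 : ContinuousAt (fun e : ℝ => K * e / (1 - K * e)) 0 := c0.div c1 (by simp)
  have c3 : ContinuousAt
      (fun e : ℝ => K / (1 - K * e) / Real.sqrt (1 - (K * e / (1 - K * e)) ^ 2)) 0 := by
    refine ContinuousAt.div (continuousAt_const.div c1 (by simp)) ?_ (by simp)
    exact (continuousAt_const.sub (c2.pow 2)).sqrt
  have e0 := c0.eventually_lt_const (u := 1) (by simp)
  have e2 := c2.eventually_lt_const (u := 1) (by simp)
  have e3 := c3.eventually_lt_const (u := K') (by simpa using hKK')
  filter_upwards [nhdsWithin_le_nhds e0, nhdsWithin_le_nhds e2, nhdsWithin_le_nhds e3,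
    self_mem_nhdsWithin] with e h0 h2 h3 hpos
  refine ⟨h0, h2, ?_⟩
  have : K * e / (1 - K * e) / Real.sqrt (1 - (K * e / (1 - K * e)) ^ 2) =
      K / (1 - K * e) / Real.sqrt (1 - (K * e / (1 - K * e)) ^ 2) * e := by ring
  rw [this]
  exact mul_le_mul_of_nonneg_right h3.le (le_of_lt hpos)

theorem riceCond_le_ofReal (δ : GrDistance) {π : Finset (Fin m)} (A : domain 𝕜 m n π) {K' : ℝ}
    (hK' : 0 < K')
    (hgap : ∀ i ∈ π, ∀ j ∉ π, gapFun (singVal (A : Matrix (Fin m) (Fin n) 𝕜) i)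
      (singVal (A : Matrix (Fin m) (Fin n) 𝕜) j) < K') :
    riceCond (fun B C : domain 𝕜 m n π =>
        frobDist (B : Matrix (Fin m) (Fin n) 𝕜) (C : Matrix (Fin m) (Fin n) 𝕜))
      (Gr.dist δ) (leftMap 𝕜 m n π) A ≤ ENNReal.ofReal K' := by
  have hsep := mem_domain_iff.mp A.2
  set A₀ : Matrix (Fin m) (Fin n) 𝕜 := (A : Matrix (Fin m) (Fin n) 𝕜) with hA₀
  -- a constant `K` between the contributions and `K'` leaves room for the change of the singular
  -- values below it and for the higher order terms above it
  obtain ⟨K, hK0, hKK', hK⟩ : ∃ K, 0 < K ∧ K < K' ∧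
      ∀ i : Fin m, ∀ j : Fin m, i ∈ π → j ∉ π → gapFun (singVal A₀ i) (singVal A₀ j) < K := by
    have h1 : ∀ᶠ K in 𝓝[<] K', ∀ i : Fin m, ∀ j : Fin m, i ∈ π → j ∉ π →
        gapFun (singVal A₀ i) (singVal A₀ j) < K := by
      refine Filter.eventually_all.mpr fun i => Filter.eventually_all.mpr fun j => ?_
      by_cases hij : i ∈ π ∧ j ∉ π
      · filter_upwards [Ioo_mem_nhdsLT (hgap i hij.1 j hij.2)] with K hK _ _
        exact hK.1
      · exact Filter.Eventually.of_forall fun K hi hj => absurd ⟨hi, hj⟩ hij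
    obtain ⟨K, h2, h3⟩ := (h1.and (Ioo_mem_nhdsLT hK')).exists
    exact ⟨K, h3.1, h3.2, h2⟩
  have hev : ∀ᶠ e in 𝓝[>] (0 : ℝ), ∀ i j : Fin m, i ∉ π → j ∈ π →
      ∀ b', |b' - singVal A₀ j| ≤ e → singVal A₀ i ≠ b' ∧ gapFun (singVal A₀ i) b' ≤ K := by
    refine Filter.eventually_all.mpr fun i => Filter.eventually_all.mpr fun j => ?_
    by_cases hij : i ∉ π ∧ j ∈ π
    · have h1 := hK j i hij.2 hij.1
      rw [gapFun_comm] at h1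
      filter_upwards [eventually_gapFun_le (singVal_nonneg A₀ i) (singVal_nonneg A₀ j)
        (hsep j hij.2 i hij.1).symm h1] with e he _ _
      exact he
    · exact Filter.Eventually.of_forall fun K hi hj => absurd ⟨hi, hj⟩ hij
  obtain ⟨u, hu, hsub⟩ := mem_nhdsGT_iff_exists_Ioo_subset.mp
    (hev.and (eventually_tan_bound hKK'))
  have hu0 : (0 : ℝ) < u := hu
  refine iInf₂_le_of_le (u / 2) (by linarith) (iSup₂_le fun A' hA' => ?_)
  refine ENNReal.ofReal_le_ofReal ?_
  simp only [frobDist_eq_norm, ← hA₀] at hA' ⊢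
  set e := ‖A₀ - (A' : Matrix (Fin m) (Fin n) 𝕜)‖ with he
  obtain ⟨hloc, h1, h2, h3⟩ := hsub (⟨hA'.1, by linarith [hA'.2]⟩ : e ∈ Set.Ioo 0 u)
  obtain ⟨U, V, hA⟩ := exists_isFullSVD A₀
  obtain ⟨U', V', hA''⟩ := exists_isFullSVD (A' : Matrix (Fin m) (Fin n) 𝕜)
  have hloc' : ∀ i ∉ π, ∀ j ∈ π, singVal A₀ i ≠ singVal (A' : Matrix (Fin m) (Fin n) 𝕜) j ∧
      gapFun (singVal A₀ i) (singVal (A' : Matrix (Fin m) (Fin n) 𝕜) j) ≤ K := by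
    intro i hi j hj
    refine hloc i j hi hj _ ?_
    rw [abs_sub_comm]
    exact singVal_sub_le _ _ _
  have hsin := sinNorm_le hA hA'' hK0.le (fun i hi j hj => (hloc' i hi j hj).1)
    (fun i hi j hj => (hloc' i hi j hj).2)
  rw [norm_sub_rev, ← he, ← dist_chordal_leftMap A A' hA hA''] at hsin
  set c := Gr.dist .chordal (leftMap 𝕜 m n π A) (leftMap 𝕜 m n π A') with hc
  have hc0 : 0 ≤ c := Real.sqrt_nonneg _
  have hcx : c ≤ K * e / (1 - K * e) := by
    rw [le_div_iff₀ (by linarith)]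
    linarith
  set x := K * e / (1 - K * e) with hx
  rw [div_le_iff₀ hA'.1]
  refine (Gr.dist_le_of_chordal_lt_one δ _ _ (hcx.trans_lt h2)).trans (le_trans ?_ h3)
  have hx1 : 0 < 1 - x ^ 2 := by nlinarith
  exact div_le_div₀ (hc0.trans hcx) hcx (Real.sqrt_pos.mpr hx1)
    (Real.sqrt_le_sqrt (by nlinarith))

theorem riceCond_le_condFormula (δ : GrDistance) {π : Finset (Fin m)} (A : domain 𝕜 m n π) :
    riceCond (fun B C : domain 𝕜 m n π =>
        frobDist (B : Matrix (Fin m) (Fin n) 𝕜) (C : Matrix (Fin m) (Fin n) 𝕜))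
      (Gr.dist δ) (leftMap 𝕜 m n π) A ≤ condFormula π (A : Matrix (Fin m) (Fin n) 𝕜) := by
  by_contra! hlt
  obtain ⟨r, h1, h2⟩ := ENNReal.lt_iff_exists_nnreal_btwn.mp hlt
  have hr : 0 < (r : ℝ) := by
    have : (0 : ℝ≥0∞) < r := lt_of_le_of_lt (zero_le) h1
    exact_mod_cast this
  have h3 := riceCond_le_ofReal δ A hr fun i hi j hj => by
    have h4 : ENNReal.ofReal (gapFun (singVal (A : Matrix (Fin m) (Fin n) 𝕜) i)
        (singVal (A : Matrix (Fin m) (Fin n) 𝕜) j)) ≤ condFormula π A.1 :=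
      le_iSup₂_of_le i hi (le_iSup₂_of_le j (Finset.mem_compl.mpr hj) le_rfl)
    have h5 := h4.trans_lt h1
    rw [← ENNReal.ofReal_coe_nnreal, ENNReal.ofReal_lt_ofReal_iff hr] at h5
    exact h5
  rw [ENNReal.ofReal_coe_nnreal] at h3
  exact absurd h2 (not_lt.mpr h3)

end UpperBound

/-! ### The lower bound -/

section LowerBound

variable {𝕜 : Type*} [RCLike 𝕜] {m n : ℕ}

/-- The rotation with cosine `a` and sine `b` in the plane of the `i`-th and the `j`-th
coordinate. -/
def planeRotation (𝕜 : Type*) [RCLike 𝕜] {p : ℕ} (i j : Fin p) (a b : ℝ) :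
    Matrix (Fin p) (Fin p) 𝕜 :=
  1 + ((a - 1 : ℝ) : 𝕜) • (Matrix.single i i 1 + Matrix.single j j 1) +
    (b : 𝕜) • (Matrix.single j i 1 - Matrix.single i j 1)

theorem planeRotation_mem_unitary {p : ℕ} {i j : Fin p} (hij : i ≠ j) {a b : ℝ}
    (hab : a ^ 2 + b ^ 2 = 1) : planeRotation 𝕜 i j a b ∈ Matrix.unitaryGroup (Fin p) 𝕜 := by
  rw [Matrix.mem_unitaryGroup_iff', Matrix.star_eq_conjTranspose, planeRotation]
  have hab' : (a : 𝕜) ^ 2 + (b : 𝕜) ^ 2 = 1 := by exact_mod_cast hab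
  simp only [Matrix.conjTranspose_add, Matrix.conjTranspose_sub, Matrix.conjTranspose_smul,
    Matrix.conjTranspose_one, Matrix.conjTranspose_single, star_one, RCLike.star_def,
    RCLike.conj_ofReal, Matrix.add_mul, Matrix.mul_add, Matrix.sub_mul, Matrix.mul_sub,
    Matrix.smul_mul, Matrix.mul_smul, Matrix.one_mul,
    Matrix.single_mul_single_same, mul_one, Matrix.single_mul_single_of_ne _ _ _ _ hij,
    Matrix.single_mul_single_of_ne _ _ _ _ hij.symm]
  push_cast
  linear_combination (norm := module) hab' • (Matrix.single i i (1 : 𝕜) + Matrix.single j j (1 : 𝕜))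

theorem planeRotation_apply_snd_fst {p : ℕ} {i j : Fin p} (hij : i ≠ j) (a b : ℝ) :
    planeRotation 𝕜 i j a b j i = b := by
  simp [planeRotation, hij, hij.symm, RCLike.real_smul_eq_coe_mul]

theorem frobenius_sq_plane {p : ℕ} {i j : Fin p} (hij : i ≠ j) (x y z w : 𝕜) :
    ‖(Matrix.single i i x + Matrix.single j j y + Matrix.single j i z + Matrix.single i j w :
      Matrix (Fin p) (Fin p) 𝕜)‖ ^ 2 = ‖x‖ ^ 2 + ‖y‖ ^ 2 + ‖z‖ ^ 2 + ‖w‖ ^ 2 := by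
  have h : ∀ k l, ‖(Matrix.single i i x + Matrix.single j j y + Matrix.single j i z +
      Matrix.single i j w : Matrix (Fin p) (Fin p) 𝕜) k l‖ ^ 2 =
      Matrix.single i i (‖x‖ ^ 2) k l + Matrix.single j j (‖y‖ ^ 2) k l +
        Matrix.single j i (‖z‖ ^ 2) k l + Matrix.single i j (‖w‖ ^ 2) k l := by
    intro k l
    simp only [Matrix.add_apply, Matrix.single_apply]
    by_cases h1 : i = k <;> by_cases h2 : j = k <;> by_cases h3 : i = l <;> by_cases h4 : j = l <;>
      simp_all
  rw [frobenius_sq]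
  simp_rw [h, Finset.sum_add_distrib, Matrix.single_apply, ite_and]
  simp

/-- How far two rotations in the same plane are from intertwining a diagonal matrix. -/
theorem frobenius_sq_planeRotation_diagonal {p : ℕ} {i j : Fin p} (hij : i ≠ j)
    (a b a' b' : ℝ) (d : Fin p → ℝ) :
    ‖planeRotation 𝕜 i j a b * Matrix.diagonal (fun k => (d k : 𝕜)) -
        Matrix.diagonal (fun k => (d k : 𝕜)) * planeRotation 𝕜 i j a' b'‖ ^ 2 =
      (a - a') ^ 2 * (d i ^ 2 + d j ^ 2) + (b * d i - b' * d j) ^ 2 + (b' * d i - b * d j) ^ 2 := by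
  have e : planeRotation 𝕜 i j a b * Matrix.diagonal (fun k => (d k : 𝕜)) -
        Matrix.diagonal (fun k => (d k : 𝕜)) * planeRotation 𝕜 i j a' b' =
      Matrix.single i i (((a - a') * d i : ℝ) : 𝕜) + Matrix.single j j (((a - a') * d j : ℝ) : 𝕜) +
        Matrix.single j i ((b * d i - b' * d j : ℝ) : 𝕜) +
        Matrix.single i j ((b' * d i - b * d j : ℝ) : 𝕜) := by
    ext k l
    simp only [planeRotation, Matrix.sub_apply, Matrix.add_apply, Matrix.smul_apply, smul_eq_mul,
      Matrix.mul_diagonal, Matrix.diagonal_mul, Matrix.single_apply, Matrix.one_apply]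
    by_cases h1 : i = k <;> by_cases h2 : j = k <;> by_cases h3 : i = l <;> by_cases h4 : j = l <;>
      by_cases h5 : k = l <;> simp_all <;> ring
  rw [e, frobenius_sq_plane hij]
  simp only [RCLike.norm_ofReal, sq_abs]
  ring

theorem truncation_mul_single {i : Fin m} {j : Fin m} (hi : (i : ℕ) < n) (hj : (j : ℕ) < n)
    (x : 𝕜) :
    truncation 𝕜 m n * (Matrix.single ⟨i, hi⟩ ⟨j, hj⟩ x : Matrix (Fin n) (Fin n) 𝕜) =
      Matrix.single i j x * truncation 𝕜 m n := by
  ext k l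
  rw [truncation_mul_apply, mul_truncation_apply]
  have hk := k.2
  have hl := l.2
  split_ifs with h1 h2 h2
  · simp [Matrix.single_apply, Fin.ext_iff]
  · have : ¬ (j : ℕ) = l := by have := j.2; omega
    simp [Fin.ext_iff, this]
  · have : ¬ (i : ℕ) = k := by omega
    simp [Fin.ext_iff, this]
  · rfl

/-- A rotation of the left singular vectors is matched by one of the right singular vectors, unless
one of the two right singular vectors is missing, where only the trivial rotation is. -/
theorem exists_unitary_truncation_mul {i j : Fin m} (hij : i ≠ j) {a b : ℝ}
    (hab : a ^ 2 + b ^ 2 = 1) (h : ((i : ℕ) < n ∧ (j : ℕ) < n) ∨ (a = 1 ∧ b = 0)) :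
    ∃ H ∈ Matrix.unitaryGroup (Fin n) 𝕜,
      truncation 𝕜 m n * H = planeRotation 𝕜 i j a b * truncation 𝕜 m n := by
  rcases h with ⟨hi, hj⟩ | ⟨rfl, rfl⟩
  · have hij' : (⟨i, hi⟩ : Fin n) ≠ ⟨j, hj⟩ := fun hh =>
      hij (Fin.ext (by simpa using hh))
    refine ⟨planeRotation 𝕜 ⟨i, hi⟩ ⟨j, hj⟩ a b, planeRotation_mem_unitary hij' hab, ?_⟩
    simp only [planeRotation, Matrix.mul_add, Matrix.add_mul, Matrix.mul_sub, Matrix.sub_mul,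
      Matrix.mul_smul, Matrix.smul_mul, Matrix.mul_one, Matrix.one_mul,
      truncation_mul_single]
  · exact ⟨1, one_mem _, by simp [planeRotation]⟩

theorem one_sub_sq_le_sqrt {t : ℝ} (h1 : t ^ 2 ≤ 1) :
    1 - t ^ 2 ≤ Real.sqrt (1 - t ^ 2) := by
  refine Real.le_sqrt_of_sq_le ?_
  nlinarith [sq_nonneg t]

/-- With the sine of the right rotation in the ratio `2 * x * y / (x ^ 2 + y ^ 2)` to that of the
left one, which minimizes the leading term of the cost, the cost of a pair of rotations is
`t / gapFun x y` to first order. -/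
theorem rotation_cost_le {x y t : ℝ} (hx : 0 ≤ x) (hy : 0 ≤ y) (hxy : x ≠ y) (ht1 : t ^ 2 ≤ 1) :
    (Real.sqrt (1 - t ^ 2) - Real.sqrt (1 - (2 * x * y / (x ^ 2 + y ^ 2) * t) ^ 2)) ^ 2 *
          (x ^ 2 + y ^ 2) +
        (t * x - 2 * x * y / (x ^ 2 + y ^ 2) * t * y) ^ 2 +
        (2 * x * y / (x ^ 2 + y ^ 2) * t * x - t * y) ^ 2 ≤
      t ^ 2 * (t ^ 2 * (x ^ 2 + y ^ 2) + (gapFun x y ^ 2)⁻¹) ∧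
    (2 * x * y / (x ^ 2 + y ^ 2) * t) ^ 2 ≤ t ^ 2 := by
  have hS : 0 < x ^ 2 + y ^ 2 := by
    rcases hx.lt_or_eq with h | h
    · positivity
    · have : 0 < y := lt_of_le_of_ne hy (h ▸ hxy)
      positivity
  have hne : x ^ 2 - y ^ 2 ≠ 0 := fun h0 => hxy ((sq_eq_sq₀ hx hy).mp (by linarith))
  set c := 2 * x * y / (x ^ 2 + y ^ 2) with hc
  have hc0 : 0 ≤ c := by positivity
  have hc1 : c ≤ 1 := by
    rw [hc, div_le_one hS]
    nlinarith [sq_nonneg (x - y)]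
  have hct : (c * t) ^ 2 ≤ t ^ 2 := by
    rw [mul_pow]
    exact mul_le_of_le_one_left (sq_nonneg t) (pow_le_one₀ hc0 hc1)
  refine ⟨?_, hct⟩
  have h1 := one_sub_sq_le_sqrt ht1
  have h2 := one_sub_sq_le_sqrt (hct.trans ht1)
  have h3 : Real.sqrt (1 - t ^ 2) ≤ 1 := Real.sqrt_le_one.mpr (by nlinarith [sq_nonneg t])
  have h4 : Real.sqrt (1 - (c * t) ^ 2) ≤ 1 :=
    Real.sqrt_le_one.mpr (by nlinarith [sq_nonneg (c * t)])
  have h5 : (Real.sqrt (1 - t ^ 2) - Real.sqrt (1 - (c * t) ^ 2)) ^ 2 ≤ (t ^ 2) ^ 2 :=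
    sq_le_sq' (by linarith) (by linarith)
  have h6 : (t * x - c * t * y) ^ 2 + (c * t * x - t * y) ^ 2 = t ^ 2 * (gapFun x y ^ 2)⁻¹ := by
    rw [gapFun, div_pow, Real.sq_sqrt hS.le, sq_abs, hc]
    field_simp
    ring
  nlinarith [mul_le_mul_of_nonneg_right h5 hS.le]

theorem sinNorm_ge {π : Finset (Fin m)} {i j : Fin m} (hi : i ∈ π) (hj : j ∉ π)
    (U U' : Matrix (Fin m) (Fin m) 𝕜) : ‖(Uᴴ * U') j i‖ ≤ sinNorm π U U' := by
  refine le_of_sq_le_sq ?_ (norm_nonneg _ : 0 ≤ sinNorm π U U')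
  rw [sinNorm_sq]
  refine le_trans ?_ (Finset.single_le_sum (f := fun k => ∑ l ∈ π, ‖(Uᴴ * U') k l‖ ^ 2)
    (fun _ _ => Finset.sum_nonneg fun _ _ => sq_nonneg _) (Finset.mem_compl.mpr hj))
  exact Finset.single_le_sum (f := fun l => ‖(Uᴴ * U') j l‖ ^ 2) (fun _ _ => sq_nonneg _) hi

theorem sinNorm_self (π : Finset (Fin m)) {U : Matrix (Fin m) (Fin m) 𝕜} (hU : Uᴴ * U = 1) :
    sinNorm π U U = 0 := by
  have h : sinNorm π U U ^ 2 = 0 := by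
    rw [sinNorm_sq, hU]
    refine Finset.sum_eq_zero fun i hi => Finset.sum_eq_zero fun j hj => ?_
    have : i ≠ j := fun hh => Finset.mem_compl.mp hi (hh ▸ hj)
    simp [this]
  exact pow_eq_zero_iff two_ne_zero |>.mp h

/-- The extremal perturbation for the pair `i`, `j`: rotate `A` on the left and on the right. The
singular values stay the same, so that the perturbed matrix is in the domain. -/
theorem exists_extremal_perturbation (δ : GrDistance) {π : Finset (Fin m)} (A : domain 𝕜 m n π)
    {i j : Fin m} (hi : i ∈ π) (hj : j ∉ π) {t : ℝ} (ht : 0 < t) (ht1 : t ≤ 1) {x y : ℝ}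
    (hx : singVal (A : Matrix (Fin m) (Fin n) 𝕜) i = x)
    (hy : singVal (A : Matrix (Fin m) (Fin n) 𝕜) j = y) :
    ∃ A' : domain 𝕜 m n π,
      0 < frobDist (A : Matrix (Fin m) (Fin n) 𝕜) (A' : Matrix (Fin m) (Fin n) 𝕜) ∧
      frobDist (A : Matrix (Fin m) (Fin n) 𝕜) (A' : Matrix (Fin m) (Fin n) 𝕜) ≤
        t * Real.sqrt (t ^ 2 * (x ^ 2 + y ^ 2) + (gapFun x y ^ 2)⁻¹) ∧
      t ≤ Gr.dist δ (leftMap 𝕜 m n π A) (leftMap 𝕜 m n π A') := by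
  have hsep := mem_domain_iff.mp A.2
  have hij : i ≠ j := fun hh => hj (hh ▸ hi)
  obtain ⟨A, hA⟩ := A
  simp only at hx hy hsep ⊢
  obtain ⟨U, V, h⟩ := exists_isFullSVD A
  have hx0 : 0 ≤ x := hx ▸ singVal_nonneg A i
  have hy0 : 0 ≤ y := hy ▸ singVal_nonneg A j
  have hxy : x ≠ y := by
    rw [← hx, ← hy]
    exact hsep i hi j hj
  have ht2 : t ^ 2 ≤ 1 := pow_le_one₀ ht.le ht1
  obtain ⟨hcost, hct⟩ := rotation_cost_le hx0 hy0 hxy ht2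
  set s := 2 * x * y / (x ^ 2 + y ^ 2) * t with hs
  set a := Real.sqrt (1 - t ^ 2) with ha
  set a' := Real.sqrt (1 - s ^ 2) with ha'
  have hat : a ^ 2 + t ^ 2 = 1 := by
    rw [ha, Real.sq_sqrt (by linarith)]
    ring
  have has : a' ^ 2 + s ^ 2 = 1 := by
    rw [ha', Real.sq_sqrt (by linarith)]
    ring
  -- a missing right singular vector belongs to the singular value `0`, and then `s = 0`
  have hcase : ((i : ℕ) < n ∧ (j : ℕ) < n) ∨ (a' = 1 ∧ s = 0) := by
    by_cases hin : (i : ℕ) < n ∧ (j : ℕ) < n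
    · exact Or.inl hin
    · right
      have hs0 : s = 0 := by
        rcases not_and_or.mp hin with h1 | h1
        · rw [hs, ← hx, singVal_of_cols_le A (not_lt.mp h1)]
          simp
        · rw [hs, ← hy, singVal_of_cols_le A (not_lt.mp h1)]
          simp
      exact ⟨by rw [ha', hs0]; simp, hs0⟩
  obtain ⟨H, hH, hJH⟩ := exists_unitary_truncation_mul (𝕜 := 𝕜) (n := n) hij has hcase
  set G := planeRotation 𝕜 i j a t with hG
  have hGu : G ∈ Matrix.unitaryGroup (Fin m) 𝕜 := planeRotation_mem_unitary hij hat
  set R := U * G * Uᴴ with hR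
  set S := V * H * Vᴴ with hS
  have hRu : R ∈ Matrix.unitaryGroup (Fin m) 𝕜 :=
    mul_mem (mul_mem h.left_unitary hGu) (Unitary.star_mem h.left_unitary)
  have hSu : S ∈ Matrix.unitaryGroup (Fin n) 𝕜 :=
    mul_mem (mul_mem h.right_unitary hH) (Unitary.star_mem h.right_unitary)
  obtain ⟨hsv, hsvd⟩ := h.unitary_mul hRu hSu
  set A' := R * A * Sᴴ with hA'
  have hdom : A' ∈ domain 𝕜 m n π := mem_domain_iff.mpr fun k hk l hl => by
    rw [hsv]
    exact hsep k hk l hl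
  have hSS : S * Sᴴ = 1 := Matrix.mem_unitaryGroup_iff.mp hSu
  have hSS' : Sᴴ * S = 1 := Matrix.mem_unitaryGroup_iff'.mp hSu
  have hRU : R * U = U * G := by
    rw [hR, Matrix.mul_assoc, h.conjTranspose_mul_left, Matrix.mul_one]
  have hsin : t ≤ sinNorm π U (R * U) := by
    refine le_trans ?_ (sinNorm_ge hi hj U (R * U))
    rw [hRU, ← Matrix.mul_assoc, h.conjTranspose_mul_left, Matrix.one_mul, hG,
      planeRotation_apply_snd_fst hij, RCLike.norm_ofReal]
    exact le_abs_self t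
  have hchord := dist_chordal_leftMap ⟨A, hA⟩ ⟨A', hdom⟩ h hsvd
  have hnorm : ‖A - A'‖ ^ 2 ≤ t ^ 2 * (t ^ 2 * (x ^ 2 + y ^ 2) + (gapFun x y ^ 2)⁻¹) := by
    have e1 : ‖A - A'‖ = ‖R * A - A * S‖ := by
      rw [norm_sub_rev, ← frobenius_mul_right hSS (A' - A), Matrix.sub_mul, hA',
        Matrix.mul_assoc (R * A), hSS', Matrix.mul_one]
    have e2 : R * A - A * S =
        U * ((G * sigmaDiag A - sigmaDiag A * planeRotation 𝕜 i j a' s) * truncation 𝕜 m n) *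
          Vᴴ := by
      have hAe : A = U * (sigmaDiag A * truncation 𝕜 m n) * Vᴴ := by
        have := h.eq_mul
        rwa [singValMatrix_eq_rectDiag, rectDiag_eq_mul_truncation] at this
      have e3 : R * A = U * (G * (sigmaDiag A * truncation 𝕜 m n)) * Vᴴ := by
        conv_lhs => rw [hAe]
        rw [← Matrix.mul_assoc R, ← Matrix.mul_assoc R, hRU]
        simp only [Matrix.mul_assoc]
      have e4 : A * S = U * (sigmaDiag A * (truncation 𝕜 m n * H)) * Vᴴ := by
        have e5 : Vᴴ * S = H * Vᴴ := by
          rw [hS, ← Matrix.mul_assoc, ← Matrix.mul_assoc, h.conjTranspose_mul_right, Matrix.one_mul]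
        conv_lhs => rw [hAe]
        rw [Matrix.mul_assoc, e5]
        simp only [Matrix.mul_assoc]
      rw [e3, e4, hJH, ← Matrix.sub_mul, ← Matrix.mul_sub, Matrix.sub_mul]
      simp only [Matrix.mul_assoc]
    rw [e1, e2, frobenius_mul_right (U := Vᴴ)
      (by rw [Matrix.conjTranspose_conjTranspose, h.conjTranspose_mul_right]),
      frobenius_mul_left h.conjTranspose_mul_left]
    refine (pow_le_pow_left₀ (norm_nonneg _) (frobenius_mul_truncation_le _) 2).trans ?_
    rw [sigmaDiag, hG, frobenius_sq_planeRotation_diagonal hij a t a' s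
      (fun k : Fin m => singVal A k), hx, hy]
    exact hcost
  refine ⟨⟨A', hdom⟩, ?_, ?_, ?_⟩
  -- the subspace has moved, so that the matrix has changed
  · rw [frobDist_eq_norm]
    refine norm_pos_iff.mpr (sub_ne_zero.mpr fun hAA => ?_)
    have h0 : (⟨A, hA⟩ : domain 𝕜 m n π) = ⟨A', hdom⟩ := Subtype.ext hAA
    rw [← h0, dist_chordal_leftMap ⟨A, hA⟩ ⟨A, hA⟩ h h,
      sinNorm_self π h.conjTranspose_mul_left] at hchord
    linarith
  · rw [frobDist_eq_norm]
    refine le_of_sq_le_sq ?_ (by positivity)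
    rw [mul_pow, Real.sq_sqrt (by positivity)]
    exact hnorm
  · exact (hsin.trans hchord.ge).trans (Gr.dist_chordal_le δ _ _)

theorem condFormula_le_riceCond (δ : GrDistance) {π : Finset (Fin m)} (A : domain 𝕜 m n π) :
    condFormula π (A : Matrix (Fin m) (Fin n) 𝕜) ≤
    riceCond (fun B C : domain 𝕜 m n π =>
        frobDist (B : Matrix (Fin m) (Fin n) 𝕜) (C : Matrix (Fin m) (Fin n) 𝕜))
      (Gr.dist δ) (leftMap 𝕜 m n π) A := by
  refine iSup₂_le fun i hi => iSup₂_le fun j hj => le_iInf₂ fun ε hε => ?_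
  rw [Finset.mem_compl] at hj
  have hne := mem_domain_iff.mp A.2 i hi j hj
  have hx0 := singVal_nonneg (A : Matrix (Fin m) (Fin n) 𝕜) i
  have hy0 := singVal_nonneg (A : Matrix (Fin m) (Fin n) 𝕜) j
  obtain ⟨x, hx⟩ : ∃ x, singVal (A : Matrix (Fin m) (Fin n) 𝕜) i = x := ⟨_, rfl⟩
  obtain ⟨y, hy⟩ : ∃ y, singVal (A : Matrix (Fin m) (Fin n) 𝕜) j = y := ⟨_, rfl⟩
  rw [hx] at hne hx0 ⊢
  rw [hy] at hne hy0 ⊢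
  have hgap : 0 < gapFun x y := by
    have hne' : x ^ 2 - y ^ 2 ≠ 0 := fun h0 => hne ((sq_eq_sq₀ hx0 hy0).mp (by linarith))
    have hS : 0 < x ^ 2 + y ^ 2 := by
      rcases hx0.lt_or_eq with h | h
      · positivity
      · have : 0 < y := lt_of_le_of_ne hy0 (h ▸ hne)
        positivity
    exact div_pos (Real.sqrt_pos.mpr hS) (abs_pos.mpr hne')
  let q : ℝ → ℝ := fun t => Real.sqrt (t ^ 2 * (x ^ 2 + y ^ 2) + (gapFun x y ^ 2)⁻¹)
  have hq0 : q 0 = (gapFun x y)⁻¹ := by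
    simp only [q]
    rw [zero_pow two_ne_zero, zero_mul, zero_add, Real.sqrt_inv, Real.sqrt_sq hgap.le]
  have hqpos : ∀ t, 0 < q t := fun t => Real.sqrt_pos.mpr (by positivity)
  have hqc : Continuous q := by
    simp only [q]
    fun_prop
  have hlim : Filter.Tendsto (fun t => ENNReal.ofReal (q t)⁻¹) (𝓝[>] (0 : ℝ))
      (𝓝 (ENNReal.ofReal (gapFun x y))) := by
    refine ENNReal.tendsto_ofReal ?_
    have h1 := (hqc.continuousAt (x := 0)).inv₀ (hqpos 0).ne'
    have h2 : Filter.Tendsto (fun t => (q t)⁻¹) (𝓝 0) (𝓝 (q 0)⁻¹) := h1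
    rw [hq0, inv_inv] at h2
    exact h2.mono_left nhdsWithin_le_nhds
  refine le_of_tendsto hlim ?_
  have hsmall : ∀ᶠ t in 𝓝 (0 : ℝ), t * q t < ε :=
    (continuous_id.mul hqc).continuousAt.eventually_lt_const (by simpa using hε)
  filter_upwards [Ioo_mem_nhdsGT one_pos, nhdsWithin_le_nhds hsmall] with t ht hts
  obtain ⟨A', h1, h2, h3⟩ := exists_extremal_perturbation δ A hi hj ht.1 ht.2.le hx hy
  refine le_trans ?_ (le_iSup₂_of_le A' ⟨h1, h2.trans hts.le⟩ le_rfl)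
  refine ENNReal.ofReal_le_ofReal ?_
  rw [le_div_iff₀ h1]
  refine le_trans ?_ h3
  calc (q t)⁻¹ * _ ≤ (q t)⁻¹ * (t * q t) :=
        mul_le_mul_of_nonneg_left h2 (inv_nonneg.mpr (hqpos t).le)
    _ = t := by
      have := (hqpos t).ne'
      field_simp

open Classical in
/-- The condition number depends on the singular values only. -/
theorem condLeft_eq (δ : GrDistance) (π : Finset (Fin m)) (A : Matrix (Fin m) (Fin n) 𝕜) :
    condLeft δ π A = if Separated π A then condFormula π A else ⊤ := by
  rw [condLeft]
  by_cases hA : Separated π A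
  · rw [if_pos hA, dif_pos (mem_domain_iff.mpr hA)]
    exact le_antisymm (riceCond_le_condFormula δ ⟨A, _⟩) (condFormula_le_riceCond δ ⟨A, _⟩)
  · rw [if_neg hA, dif_neg fun h => hA (mem_domain_iff.mp h)]

end LowerBound

end

end SingularSubspace

theorem corollary3 (m n : ℕ) (π : Finset (Fin m)) (δ : SingularSubspace.GrDistance)
    (A : Matrix (Fin m) (Fin n) ℝ) :
    SingularSubspace.condLeft δ π A =
      SingularSubspace.condLeft δ π (A.map (fun x : ℝ => (x : ℂ))) := by
  rw [SingularSubspace.condLeft_eq, SingularSubspace.condLeft_eq, SingularSubspace.condFormula,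
    SingularSubspace.condFormula, SingularSubspace.Separated, SingularSubspace.Separated,
    SingularSubspace.singVal_map_ofReal]
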